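/- Let $n\ge 2$ and let $\Phi$ be the root system of type $B_n$ or $C_n$, with positive roots $$B_n^+=\{\epsilon_i\pm\epsilon_j,\ 1\le i<j\le n\}\cup\{\epsilon_i,\ 1\le i\le n\},\qquad C_n^+=\{\epsilon_i\pm\epsilon_j,\ 1\le i<j\le n\}\cup\{2\epsilon_i,\ 1\le i\le n\},$$ and fundamental roots $\alpha_i=\epsilon_i-\epsilon_{i+1}$ for $1\le i<n$, and $\alpha_n=\epsilon_n$ (type $B_n$) or $\alpha_n=2\epsilon_n$ (type $C_n$). Let $W$ be its Weyl group, with simple reflections $s_1,\dots,s_n$ and length function $l$. We identify $W$ with the hyperoctahedral group of permutations $w$ of $\{\pm1,\dots,\pm n\}$ with $w(-i)=-w(i)$, which acts by $w(\epsilon_i)=\epsilon_{w(i)}$, where $\epsilon_{-i}=-\epsilon_i$. Let $\mathbb C[\mathfrak h]=\mathbb C[\epsilon_1,\dots,\epsilon_n]$. For $w,v\in W$ fix a reduced expression $w=s_{i_1}\cdots s_{i_l}$ and put $$c_{w,v}=(-1)^{l(w)}\sum\prod_{k=1}^{l}\frac{1}{s_{i_1}^{e_1}\cdots s_{i_k}^{e_k}\alpha_{i_k}}\in\mathbb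 C(\mathfrak h),$$ the sum being over all $(e_1,\dots,e_l)\in\{0,1\}^l$ with $s_{i_1}^{e_1}\cdots s_{i_l}^{e_l}=v$. The Kostant–Kumar polynomial of $w$ is $$d_w=(-1)^{l(w)}\,c_{w,\mathrm{id}}\prod_{\alpha\in\Phi^+}\alpha .$$ For an involution $w\in W$ (i.e. $w^2=\mathrm{id}$), let $\mathrm{Supp}(w)\subseteq\Phi^+$ consist of the roots $\epsilon_i-\epsilon_j$ with $i<j$ and $w(i)=j$, the roots $\epsilon_i+\epsilon_j$ with $i<j$ and $w(i)=-j$, and the roots $\epsilon_i$ (type $B_n$) or $2\epsilon_i$ (type $C_n$) with $w(i)=-i$. Let $\mathcal C_1\subseteq\Phi^+$ be the first column, consisting of $\epsilon_1\pm\epsilon_j$ for $1<j\le n$ together with $\epsilon_1$ (type $B_n$) or $2\epsilon_1$ (type $C_n$). The set $\mathrm{Supp}(w)\cap\mathcal C_1$ has at most one element. Lemma. Let $w\in W$ be an involution. Then $d_w$ is a polynomial, i.e. $d_w\in\mathbb C[\mathfrak h]$. If $\mathrm{Supp}(w)\cap\mathcal C_1=\varnothing$, then every $\alpha\in\mathcal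 C_1$ divides $d_w$ in $\mathbb C[\mathfrak h]$. If $\mathrm{Supp}(w)\cap\mathcal C_1=\{\beta\}$, then $\beta$ does not divide $d_w$ in $\mathbb C[\mathfrak h]$. -/

import Mathlib

/-! Root systems of types `B_n` and `C_n`, their Weyl group (the hyperoctahedral group), and
Kostant--Kumar polynomials.  Indices `1, …, n` are modelled by `Fin n` (shifted by one). -/

namespace KostantKumar

/-- The two families of root systems. -/
inductive BCType
  | B
  | C

/-- The coefficient of `ε_i` in the positive root proportional to `ε_i`:
`ε_i` in type `B_n` and `2 ε_i` in type `C_n`. -/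
def BCType.mult : BCType → ℤ
  | .B => 1
  | .C => 2

/-- The letters `1, …, n, -n, …, -1`: `Sum.inl i` is the letter `i` and `Sum.inr i` is the
letter `-i`; negation of letters is `Sum.swap`. -/
abbrev Letter (n : ℕ) : Type := Fin n ⊕ Fin n

/-- The hyperoctahedral group: permutations `w` of the letters with `w (-x) = -w x`. -/
def hyperoctahedral (n : ℕ) : Subgroup (Equiv.Perm (Letter n)) where
  carrier := {w | ∀ x, w x.swap = (w x).swap}
  mul_mem' := by
    intro a b ha hb x
    simp only [Equiv.Perm.mul_apply, Set.mem_ofPred_eq] at *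
    rw [hb, ha]
  one_mem' := by intro x; rfl
  inv_mem' := by
    intro a ha x
    rw [Equiv.Perm.inv_eq_iff_eq, ha, ← Equiv.Perm.mul_apply, mul_inv_cancel, Equiv.Perm.one_apply]

/-- The Weyl group of type `B_n` and of type `C_n`. -/
abbrev W (n : ℕ) : Type := hyperoctahedral n

/-! ### Roots -/

/-- The standard basis vector `ε_i`. -/
def eps {n : ℕ} (i : Fin n) : Fin n → ℤ := Pi.single i 1

/-- `ε_x` for a letter `x`, with `ε_{-i} = -ε_i`. -/
def epsLetter {n : ℕ} : Letter n → (Fin n → ℤ) := Sum.elim eps (fun i => -eps i)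

/-- The linear action of the Weyl group on vectors, determined by `w ε_i = ε_{w i}`. -/
def act {n : ℕ} (w : W n) (v : Fin n → ℤ) : Fin n → ℤ :=
  ∑ i, v i • epsLetter (w.1 (Sum.inl i))

/-- The set `Φ⁺` of positive roots: `ε_i - ε_j`, `ε_i + ε_j` for `i < j`, and
`ε_i` (type `B_n`) or `2 ε_i` (type `C_n`). -/
def positiveRoots (Φ : BCType) (n : ℕ) : Finset (Fin n → ℤ) :=
  ((Finset.univ.filter fun p : Fin n × Fin n => p.1 < p.2).image fun p => eps p.1 - eps p.2) ∪
  ((Finset.univ.filter fun p : Fin n × Fin n => p.1 < p.2).image fun p => eps p.1 + eps p.2) ∪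
  (Finset.univ.image fun i : Fin n => Φ.mult • eps i)

/-- The first column `C_1` of `Φ⁺`: the roots `ε_1 - ε_j`, `ε_1 + ε_j` for `1 < j`, and
`ε_1` (type `B_n`) or `2 ε_1` (type `C_n`).  The index `1` is the `i : Fin n` with value `0`. -/
def firstColumn (Φ : BCType) (n : ℕ) : Set (Fin n → ℤ) :=
  {α | ∃ i : Fin n, i.val = 0 ∧
    ((∃ j, i < j ∧ α = eps i - eps j) ∨ (∃ j, i < j ∧ α = eps i + eps j) ∨
      α = Φ.mult • eps i)}

/-- The support of an involution `σ`. -/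
def supp (Φ : BCType) {n : ℕ} (σ : W n) : Set (Fin n → ℤ) :=
  {α | (∃ i j : Fin n, i < j ∧ σ.1 (Sum.inl i) = Sum.inl j ∧ α = eps i - eps j) ∨
    (∃ i j : Fin n, i < j ∧ σ.1 (Sum.inl i) = Sum.inr j ∧ α = eps i + eps j) ∨
    (∃ i : Fin n, σ.1 (Sum.inl i) = Sum.inr i ∧ α = Φ.mult • eps i)}

/-- The fundamental roots: `α_i = ε_i - ε_{i+1}` for `i < n`, and `α_n = ε_n` (type `B_n`)
or `α_n = 2 ε_n` (type `C_n`). -/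
def simpleRoot (Φ : BCType) {n : ℕ} (i : Fin n) : Fin n → ℤ :=
  if h : i.val + 1 < n then eps i - eps ⟨i.val + 1, h⟩ else Φ.mult • eps i

/-- The simple reflections as permutations of the letters: `s_i = (i, i+1)(-i, -(i+1))` for
`i < n`, and `s_n = (n, -n)`. -/
def simplePerm {n : ℕ} (i : Fin n) : Equiv.Perm (Letter n) :=
  if h : i.val + 1 < n then
    Equiv.swap (Sum.inl i) (Sum.inl ⟨i.val + 1, h⟩) *
      Equiv.swap (Sum.inr i) (Sum.inr ⟨i.val + 1, h⟩)
  else Equiv.swap (Sum.inl i) (Sum.inr i)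

theorem simplePerm_mem {n : ℕ} (i : Fin n) : simplePerm i ∈ hyperoctahedral n := by
  intro x
  unfold simplePerm
  split_ifs with h
  · rcases x with x | x <;>
      simp only [Sum.swap_inl, Sum.swap_inr, Equiv.Perm.mul_apply, Equiv.swap_apply_def] <;>
      split_ifs <;> simp_all
  · rcases x with x | x <;>
      simp only [Sum.swap_inl, Sum.swap_inr, Equiv.swap_apply_def] <;>
      split_ifs <;> simp_all

/-- The simple reflection `s_i` as an element of the Weyl group. -/
def simpleReflection {n : ℕ} (i : Fin n) : W n := ⟨simplePerm i, simplePerm_mem i⟩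

/-! ### Words, length, reduced expressions -/

/-- The element `s_{i_1} ⋯ s_{i_l}` for the word `(i_1, …, i_l)`. -/
def wordProd {n : ℕ} (ω : List (Fin n)) : W n := (ω.map simpleReflection).prod

/-- The length of `w` with respect to the simple reflections. -/
noncomputable def length {n : ℕ} (w : W n) : ℕ :=
  sInf {l | ∃ ω : List (Fin n), wordProd ω = w ∧ ω.length = l}

/-- `ω` is a reduced expression of `w`. -/
def IsReducedExpr {n : ℕ} (w : W n) (ω : List (Fin n)) : Prop :=
  wordProd ω = w ∧ ω.length = length w

theorem sumCongr_mem_closure {n : ℕ} (π : Equiv.Perm (Fin n)) :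
    Equiv.Perm.sumCongr π π ∈
      Submonoid.closure (Set.range (simplePerm : Fin n → Equiv.Perm (Letter n))) := by
  obtain _ | m := n
  · have h : Equiv.Perm.sumCongr π π = 1 := Subsingleton.elim _ _
    rw [h]
    exact one_mem _
  · have hπ : π ∈ Submonoid.closure
        (Set.range fun i : Fin m => Equiv.swap i.castSucc i.succ) := by
      rw [Equiv.Perm.mclosure_swap_castSucc_succ]
      trivial
    induction hπ using Submonoid.closure_induction with
    | mem x hx =>
      obtain ⟨i, rfl⟩ := hx
      refine Submonoid.subset_closure ⟨i.castSucc, ?_⟩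
      have hi : i.castSucc.val + 1 < m + 1 := by simp
      ext x
      unfold simplePerm
      rw [dif_pos hi]
      have hs : (⟨i.castSucc.val + 1, hi⟩ : Fin (m + 1)) = i.succ := by ext; simp
      rw [hs]
      rcases x with x | x <;>
        simp only [Equiv.Perm.mul_apply, Equiv.swap_apply_def, Equiv.Perm.sumCongr_apply,
          Sum.map_inl, Sum.map_inr] <;>
        split_ifs <;> simp_all
    | one =>
      rw [Equiv.Perm.sumCongr_one]
      exact one_mem _
    | mul x y _ _ hx hy =>
      rw [← Equiv.Perm.sumCongr_mul]
      exact mul_mem hx hy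

theorem signChange_mem_closure {n : ℕ} (i : Fin n) :
    Equiv.swap (Sum.inl i : Letter n) (Sum.inr i) ∈
      Submonoid.closure (Set.range (simplePerm : Fin n → Equiv.Perm (Letter n))) := by
  obtain _ | m := n
  · exact i.elim0
  · have hl : Equiv.swap (Sum.inl (Fin.last m) : Letter (m + 1)) (Sum.inr (Fin.last m)) ∈
        Submonoid.closure
          (Set.range (simplePerm : Fin (m + 1) → Equiv.Perm (Letter (m + 1)))) := by
      refine Submonoid.subset_closure ⟨Fin.last m, ?_⟩
      unfold simplePerm
      rw [dif_neg (by simp)]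
    have hc := sumCongr_mem_closure (Equiv.swap i (Fin.last m))
    have key : Equiv.swap (Sum.inl i : Letter (m + 1)) (Sum.inr i) =
        Equiv.Perm.sumCongr (Equiv.swap i (Fin.last m)) (Equiv.swap i (Fin.last m)) *
        Equiv.swap (Sum.inl (Fin.last m)) (Sum.inr (Fin.last m)) *
        Equiv.Perm.sumCongr (Equiv.swap i (Fin.last m)) (Equiv.swap i (Fin.last m)) := by
      ext x
      rcases x with x | x <;>
        simp only [Equiv.Perm.mul_apply, Equiv.swap_apply_def, Equiv.Perm.sumCongr_apply,
          Sum.map_inl, Sum.map_inr] <;>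
        split_ifs <;> simp_all [Equiv.swap_apply_def]
    rw [key]
    exact mul_mem (mul_mem hc hl) hc

theorem hyperoctahedral_le_closure {n : ℕ} (w : Equiv.Perm (Letter n))
    (hw : w ∈ hyperoctahedral n) :
    w ∈ Submonoid.closure (Set.range (simplePerm : Fin n → Equiv.Perm (Letter n))) := by
  induction hk : (Finset.univ.filter fun i : Fin n => (w (Sum.inl i)).isRight).card
    using Nat.strong_induction_on generalizing w with
  | _ k ih =>
  by_cases h : ∃ i : Fin n, (w (Sum.inl i)).isRight
  · obtain ⟨i, hi⟩ := h
    have hsw : w (Sum.inr i) = (w (Sum.inl i)).swap := hw (Sum.inl i)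
    have ht : Equiv.swap (Sum.inl i : Letter n) (Sum.inr i) ∈ hyperoctahedral n := by
      intro x
      rcases x with x | x <;>
        simp only [Sum.swap_inl, Sum.swap_inr, Equiv.swap_apply_def] <;>
        split_ifs <;> simp_all
    have hlt : (Finset.univ.filter fun j : Fin n =>
        ((w * Equiv.swap (Sum.inl i) (Sum.inr i)) (Sum.inl j)).isRight).card < k := by
      rw [← hk]
      apply Finset.card_lt_card
      rw [Finset.ssubset_iff_of_subset]
      · refine ⟨i, by simpa using hi, ?_⟩
        obtain ⟨j, hj⟩ := Sum.isRight_iff.mp hi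
        intro hmem
        have h3 := (Finset.mem_filter.mp hmem).2
        rw [Equiv.Perm.mul_apply, Equiv.swap_apply_left, hsw, hj] at h3
        simp at h3
      · intro j hj
        by_cases hji : j = i
        · subst hji
          simpa using hi
        · simpa [Equiv.swap_apply_def, hji] using hj
    have := ih _ hlt _ (mul_mem hw ht) rfl
    have h2 := mul_mem this (signChange_mem_closure i)
    rwa [mul_assoc, Equiv.swap_mul_self, mul_one] at h2
  · have h' : ∀ i : Fin n, ∃ j : Fin n, w (Sum.inl i) = Sum.inl j := by
      intro i
      rcases hwi : w (Sum.inl i) with j | j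
      · exact ⟨j, rfl⟩
      · exact absurd ⟨i, by simp [hwi]⟩ h
    choose f hf using h'
    have hinj : Function.Injective f := by
      intro a b hab
      have : w (Sum.inl a) = w (Sum.inl b) := by rw [hf, hf, hab]
      exact Sum.inl_injective (w.injective this)
    have : w = Equiv.Perm.sumCongr (Equiv.ofBijective f (Finite.injective_iff_bijective.mp hinj))
        (Equiv.ofBijective f (Finite.injective_iff_bijective.mp hinj)) := by
      ext x
      rcases x with x | x
      · simp [hf]
      · have hsw : w (Sum.inr x) = (w (Sum.inl x)).swap := hw (Sum.inl x)
        simp [hsw, hf]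
    rw [this]
    exact sumCongr_mem_closure _

/-- The simple reflections generate the hyperoctahedral group. -/
theorem exists_wordProd_eq {n : ℕ} (w : W n) : ∃ ω : List (Fin n), wordProd ω = w := by
  obtain ⟨w, hw⟩ := w
  suffices h : ∃ ω : List (Fin n), (ω.map simplePerm).prod = w by
    obtain ⟨ω, hω⟩ := h
    refine ⟨ω, Subtype.ext ?_⟩
    have h1 : ((wordProd ω : W n) : Equiv.Perm (Letter n)) = (ω.map simplePerm).prod := by
      unfold wordProd
      rw [← Subgroup.subtype_apply, map_list_prod, List.map_map]
      rfl
    rw [h1, hω]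
  have h := hyperoctahedral_le_closure w hw
  clear hw
  induction h using Submonoid.closure_induction with
  | mem x hx => obtain ⟨i, rfl⟩ := hx; exact ⟨[i], by simp⟩
  | one => exact ⟨[], by simp⟩
  | mul x y _ _ hx hy =>
    obtain ⟨a, rfl⟩ := hx
    obtain ⟨b, rfl⟩ := hy
    exact ⟨a ++ b, by simp⟩

/-- Every element of the Weyl group has a reduced expression. -/
theorem exists_isReducedExpr {n : ℕ} (w : W n) : ∃ ω : List (Fin n), IsReducedExpr w ω := by
  obtain ⟨ω, hω⟩ := exists_wordProd_eq w
  exact Nat.sInf_mem (s := {l | ∃ ω : List (Fin n), wordProd ω = w ∧ ω.length = l})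
    ⟨_, ω, hω, rfl⟩

/-- A fixed reduced expression of `w`. -/
noncomputable def reducedExpr {n : ℕ} (w : W n) : List (Fin n) :=
  (exists_isReducedExpr w).choose

/-! ### Kostant--Kumar polynomials -/

/-- The polynomial ring `ℂ[𝔥]`; the variable `X i` is the linear function `ε_i` on `𝔥`. -/
abbrev PolyRing (n : ℕ) : Type := MvPolynomial (Fin n) ℂ

/-- The field `ℂ(𝔥)` of rational functions. -/
abbrev RatFun (n : ℕ) : Type := FractionRing (PolyRing n)

/-- The linear function on `𝔥` given by an integer combination of the `ε_i`. -/
noncomputable def linForm {n : ℕ} (v : Fin n → ℤ) : PolyRing n :=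
  ∑ i, MvPolynomial.C (v i : ℂ) * MvPolynomial.X i

/-- For a word `ω = (i_1, …, i_l)` and `e = (e_1, …, e_l) ∈ {0,1}^l`, the product
`s_{i_1}^{e_1} ⋯ s_{i_k}^{e_k}` of the first `k` factors. -/
def partialProd {n : ℕ} (ω : List (Fin n)) (e : Fin ω.length → Fin 2) (k : ℕ) : W n :=
  ((List.ofFn fun j : Fin ω.length => simpleReflection (ω.get j) ^ (e j).val).take k).prod

open Classical in
/-- The rational function `c_{w,v}`, computed from the word `ω` of length `l`:
`(-1)^l ∑_e ∏_{k=1}^{l} (s_{i_1}^{e_1} ⋯ s_{i_k}^{e_k} α_{i_k})⁻¹`, the sum being over all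
`e ∈ {0,1}^l` with `s_{i_1}^{e_1} ⋯ s_{i_l}^{e_l} = v`. -/
noncomputable def cWord (Φ : BCType) {n : ℕ} (ω : List (Fin n)) (v : W n) : RatFun n :=
  (-1) ^ ω.length *
    ∑ e ∈ Finset.univ.filter
        (fun e : Fin ω.length → Fin 2 => partialProd ω e ω.length = v),
      ∏ k : Fin ω.length,
        (algebraMap (PolyRing n) (RatFun n)
          (linForm (act (partialProd ω e (k.val + 1)) (simpleRoot Φ (ω.get k)))))⁻¹

/-- The rational function `c_{w,v}`. -/
noncomputable def cRat (Φ : BCType) {n : ℕ} (w v : W n) : RatFun n := cWord Φ (reducedExpr w) v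

/-- `d_w = (-1)^{l(w)} c_{w,id} ∏_{α ∈ Φ⁺} α`, as a rational function. -/
noncomputable def dRat (Φ : BCType) {n : ℕ} (w : W n) : RatFun n :=
  (-1) ^ length w * cRat Φ w 1 *
    ∏ α ∈ positiveRoots Φ n, algebraMap (PolyRing n) (RatFun n) (linForm α)

end KostantKumar

namespace KostantKumar

variable {n : ℕ} {Φ : BCType}

/-! ### Letters and roots -/

/-! Start with the function on `W` equal to the product of all positive roots at the identity and to
zero elsewhere, and apply the divided differences `p ↦ (u ↦ (p u - p (u s_i)) / (u α_i))` along a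
reduced word of `w⁻¹`. The result is `kkFamily Φ w`. Splitting the sum for `c_{w,id}` according to
`e_1` gives the same recursion, so for an involution `d_w = kkFamily Φ w 1` (`algebraMap_kkFamily`).
The values are polynomials because divided differences preserve the congruences `p u ≡ p (s_β u)`
modulo `β` (`IsGKM.dividedDifference`).

A degree count shows that the family does not depend on the reduced word (`wordFamily_eq`). Hence,
writing `K_w` for it, every right descent `s_i` of `w` gives `(u α_i) K_w(u) = K_{w s_i}(u) - K_{w
s_i}(u s_i)` (`kkFamily_descent`).

If the support misses the first column, then `w 1 = 1`, so `w` is a product of simple reflections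
fixing the letter `1`. Then `K_w` lives on elements fixing `1`, where all divisions are by roots
without `ε_1`; the column roots in the initial product are never cancelled (`linForm_dvd_kkFamily`).

If `w 1 = z ≠ 1`, then `w z = 1`, and the column root in the support is the one joining `1` and `z`.
It is enough that `K_w(1)` is nonzero at one point where this root vanishes. The point is `(t, n -
1, …, 1)`, with `t` the value of `ε_z` if `z ≠ -1` and `t = 0` if `z = -1`. Move the letter `x = w⁻¹
1` step by step up to `1` by right descents of `w`. At each step one of the two terms on the right
vanishes at the point, and the other continues the path. For `z ≠ -1`, the last step divides the
full column product exactly by the vanishing root. For `z = -1`, the cancellation of `ε_1` occurs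
where the path crosses from `-n` to `n`. What remains is a nonzero multiple of some `K_p(u)` with
`p` and `u` fixing `1` and `u` below `p` in the weak order; this is nonzero by positivity at `(n, n
- 1, …, 1)` (`eval_kkFamily_pos`). -/

theorem BCType.mult_pos (Φ : BCType) : 0 < Φ.mult := by cases Φ <;> simp [BCType.mult]

/-- The pairing of `ε_x` with the vector `(n, n - 1, …, 1)`. -/
def height (x : Letter n) : ℤ := Sum.elim (fun i : Fin n => (n : ℤ) - i) (fun i => (i : ℤ) - n) x

@[simp] theorem height_inl (i : Fin n) : height (Sum.inl i) = (n : ℤ) - i := rfl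

@[simp] theorem height_inr (i : Fin n) : height (Sum.inr i) = (i : ℤ) - n := rfl

@[simp] theorem height_swap (x : Letter n) : height x.swap = -height x := by
  rcases x with i | i <;> simp

theorem height_injective : Function.Injective (height : Letter n → ℤ) := by
  rintro (i | i) (j | j) h <;> simp only [height_inl, height_inr] at h
  · congr 1; ext; omega
  · omega
  · omega
  · congr 1; ext; omega

theorem height_inj {x y : Letter n} : height x = height y ↔ x = y := height_injective.eq_iff

theorem height_ne_zero (x : Letter n) : height x ≠ 0 := by
  rcases x with i | i <;> simp only [height_inl, height_inr] <;> omega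

theorem height_le (x : Letter n) : height x ≤ n := by
  rcases x with i | i <;> simp only [height_inl, height_inr] <;> omega

theorem neg_le_height (x : Letter n) : -(n : ℤ) ≤ height x := by
  rcases x with i | i <;> simp only [height_inl, height_inr] <;> omega

@[simp] theorem epsLetter_inl (i : Fin n) : epsLetter (Sum.inl i) = eps i := rfl

@[simp] theorem epsLetter_inr (i : Fin n) : epsLetter (Sum.inr i) = -eps i := rfl

@[simp] theorem epsLetter_swap (x : Letter n) : epsLetter x.swap = -epsLetter x := by
  rcases x with i | i <;> simp

theorem swap_ne_self (x : Letter n) : x.swap ≠ x := by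
  rcases x with i | i <;> simp

theorem W.apply_swap (w : W n) (x : Letter n) : w.1 x.swap = (w.1 x).swap := w.2 x

theorem W.ext_inl {u v : W n} (h : ∀ i, u.1 (Sum.inl i) = v.1 (Sum.inl i)) : u = v := by
  apply Subtype.ext
  ext x : 1
  rcases x with i | i
  · exact h i
  · have hu := u.apply_swap (Sum.inl i)
    have hv := v.apply_swap (Sum.inl i)
    rw [h i, ← hv] at hu
    exact hu

@[simp] theorem W.mul_apply (u v : W n) (x : Letter n) : (u * v).1 x = u.1 (v.1 x) := rfl

@[simp] theorem W.one_apply (x : Letter n) : (1 : W n).1 x = x := rfl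

@[simp] theorem W.inv_apply_self (u : W n) (x : Letter n) : (u⁻¹).1 (u.1 x) = x :=
  u.1.symm_apply_apply x

@[simp] theorem W.apply_inv_self (u : W n) (x : Letter n) : u.1 ((u⁻¹).1 x) = x :=
  u.1.apply_symm_apply x

theorem W.injective (u : W n) : Function.Injective u.1 := u.1.injective

/-- The root attached to two distinct letters: `ε_a - ε_b`, or the multiple of `ε_a` if `b = -a`. -/
def root (Φ : BCType) (a b : Letter n) : Fin n → ℤ :=
  if b = a.swap then Φ.mult • epsLetter a else epsLetter a - epsLetter b

theorem root_swap_swap (a b : Letter n) : root Φ b.swap a.swap = root Φ a b := by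
  unfold root
  have : a.swap = b.swap.swap ↔ b = a.swap := by
    constructor
    · intro h; rw [h]; simp
    · rintro rfl; simp
  by_cases h : b = a.swap
  · subst h; simp
  · rw [if_neg h, if_neg (by rwa [this])]
    simp; abel

theorem root_comm (a b : Letter n) : root Φ b a = -root Φ a b := by
  unfold root
  by_cases h : b = a.swap
  · subst h; simp
  · have : ¬ a = b.swap := by rintro rfl; simp at h
    rw [if_neg h, if_neg this]; abel

/-! ### The action -/

theorem act_add (w : W n) (x y : Fin n → ℤ) : act w (x + y) = act w x + act w y := by
  simp [act, add_smul, Finset.sum_add_distrib]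

theorem act_smul (w : W n) (c : ℤ) (x : Fin n → ℤ) : act w (c • x) = c • act w x := by
  simp [act, mul_smul, Finset.smul_sum]

theorem act_neg (w : W n) (x : Fin n → ℤ) : act w (-x) = -act w x := by
  simp [act]

theorem act_sub (w : W n) (x y : Fin n → ℤ) : act w (x - y) = act w x - act w y := by
  rw [sub_eq_add_neg, act_add, act_neg, sub_eq_add_neg]

theorem act_sum {ι : Type*} (s : Finset ι) (w : W n) (f : ι → Fin n → ℤ) :
    act w (∑ i ∈ s, f i) = ∑ i ∈ s, act w (f i) := by
  classical
  induction s using Finset.induction_on with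
  | empty => simp [act]
  | insert a s ha ih => rw [Finset.sum_insert ha, Finset.sum_insert ha, act_add, ih]

theorem act_eps (w : W n) (i : Fin n) : act w (eps i) = epsLetter (w.1 (Sum.inl i)) := by
  unfold act
  rw [Finset.sum_eq_single i]
  · simp [eps]
  · intro j _ hj; simp [eps, hj]
  · simp

@[simp] theorem act_epsLetter (w : W n) (x : Letter n) :
    act w (epsLetter x) = epsLetter (w.1 x) := by
  rcases x with i | i
  · exact act_eps w i
  · rw [epsLetter_inr, act_neg, act_eps, ← epsLetter_swap, ← w.apply_swap]; rfl

theorem eq_sum_eps (x : Fin n → ℤ) : x = ∑ i, x i • eps i := by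
  ext j
  simp [eps, Finset.sum_apply, Pi.single_apply]

@[simp] theorem act_mul (u v : W n) (x : Fin n → ℤ) : act (u * v) x = act u (act v x) := by
  rw [show act v x = ∑ i, x i • epsLetter (v.1 (Sum.inl i)) from rfl, act_sum]
  simp only [act_smul, act_epsLetter]
  rfl

@[simp] theorem act_one (x : Fin n → ℤ) : act (1 : W n) x = x := by
  conv_rhs => rw [eq_sum_eps x]
  rfl

@[simp] theorem act_inv_act (u : W n) (x : Fin n → ℤ) : act u⁻¹ (act u x) = x := by
  rw [← act_mul, inv_mul_cancel, act_one]

@[simp] theorem act_act_inv (u : W n) (x : Fin n → ℤ) : act u (act u⁻¹ x) = x := by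
  rw [← act_mul, mul_inv_cancel, act_one]

theorem epsLetter_injective : Function.Injective (epsLetter : Letter n → Fin n → ℤ) := by
  rintro (i | i) (j | j) h
  · have := congrFun h i
    simp [eps, Pi.single_apply] at this
    rw [this]
  · have := congrFun h i
    simp [eps, Pi.single_apply] at this
    split_ifs at this
    omega
  · have := congrFun h i
    simp [eps, Pi.single_apply] at this
    split_ifs at this
  · have := congrFun h i
    simp [eps, Pi.single_apply] at this
    rw [this]

theorem act_injective {u v : W n} (h : ∀ x, act u x = act v x) : u = v := by
  apply W.ext_inl
  intro i
  have := h (eps i)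
  rw [act_eps, act_eps] at this
  exact epsLetter_injective this

theorem act_root (w : W n) (a b : Letter n) : act w (root Φ a b) = root Φ (w.1 a) (w.1 b) := by
  unfold root
  have h : w.1 b = (w.1 a).swap ↔ b = a.swap := by rw [← w.apply_swap, w.injective.eq_iff]
  by_cases hb : b = a.swap
  · rw [if_pos hb, if_pos (h.mpr hb), act_smul, act_epsLetter]
  · rw [if_neg hb, if_neg (mt h.mp hb), act_sub, act_epsLetter, act_epsLetter]

/-! ### Positive roots -/

theorem mem_positiveRoots {v : Fin n → ℤ} :
    v ∈ positiveRoots Φ n ↔ ∃ a b : Letter n, height b < height a ∧ v = root Φ a b := by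
  simp only [positiveRoots, Finset.mem_union, Finset.mem_image, Finset.mem_filter,
    Finset.mem_univ, true_and, Prod.exists]
  constructor
  · rintro ((⟨i, j, h, rfl⟩ | ⟨i, j, h, rfl⟩) | ⟨i, rfl⟩)
    · exact ⟨Sum.inl i, Sum.inl j, by simp; omega, by simp [root]⟩
    · refine ⟨Sum.inl i, Sum.inr j, by simp; omega, ?_⟩
      have : j ≠ i := h.ne'
      simp [root, this]
    · exact ⟨Sum.inl i, Sum.inr i, by simp; omega, by simp [root]⟩
  · rintro ⟨i | i, j | j, h, rfl⟩ <;> simp only [height_inl, height_inr] at h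
    · exact Or.inl (Or.inl ⟨i, j, by omega, by simp [root]⟩)
    · rcases lt_trichotomy i j with hij | rfl | hij
      · exact Or.inl (Or.inr ⟨i, j, hij, by simp [root, hij.ne']⟩)
      · exact Or.inr ⟨i, by simp [root]⟩
      · exact Or.inl (Or.inr ⟨j, i, hij, by simp [root, hij.ne]; abel⟩)
    · omega
    · exact Or.inl (Or.inl ⟨j, i, by omega, by simp [root]; abel⟩)

/-- The pairing with `(n, n - 1, …, 1)`. -/
def rho (v : Fin n → ℤ) : ℤ := ∑ i, v i * ((n : ℤ) - i)

theorem rho_add (x y : Fin n → ℤ) : rho (x + y) = rho x + rho y := by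
  simp [rho, add_mul, Finset.sum_add_distrib]

theorem rho_neg (x : Fin n → ℤ) : rho (-x) = -rho x := by
  simp [rho]

theorem rho_smul (c : ℤ) (x : Fin n → ℤ) : rho (c • x) = c * rho x := by
  simp [rho, Finset.mul_sum, mul_assoc]

@[simp] theorem rho_epsLetter (x : Letter n) : rho (epsLetter x) = height x := by
  have h : ∀ i : Fin n, rho (eps i) = n - i := by
    intro i
    unfold rho
    rw [Finset.sum_eq_single i]
    · simp [eps]
    · intro j _ hj; simp [eps, hj]
    · simp
  rcases x with i | i
  · exact h i
  · rw [epsLetter_inr, rho_neg, h]; simp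

theorem rho_root_pos {a b : Letter n} (h : height b < height a) : 0 < rho (root Φ a b) := by
  unfold root
  split_ifs with hb
  · subst hb
    rw [rho_smul, rho_epsLetter]
    rw [height_swap] at h
    exact mul_pos Φ.mult_pos (by omega)
  · rw [sub_eq_add_neg, rho_add, rho_neg, rho_epsLetter, rho_epsLetter]
    omega

theorem rho_pos {v : Fin n → ℤ} (h : v ∈ positiveRoots Φ n) : 0 < rho v := by
  obtain ⟨a, b, hab, rfl⟩ := mem_positiveRoots.mp h
  exact rho_root_pos hab

theorem root_mem_positiveRoots {a b : Letter n} (hab : a ≠ b) :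
    root Φ a b ∈ positiveRoots Φ n ↔ height b < height a := by
  constructor
  · intro h
    have h1 := rho_pos h
    by_contra h2
    have h3 : height a < height b := lt_of_le_of_ne (not_lt.mp h2) fun h => hab (height_inj.mp h)
    have := rho_root_pos (Φ := Φ) h3
    rw [root_comm, rho_neg] at this
    omega
  · intro h
    exact mem_positiveRoots.mpr ⟨a, b, h, rfl⟩

theorem neg_notMem {v : Fin n → ℤ} (h : v ∈ positiveRoots Φ n) : -v ∉ positiveRoots Φ n := by
  intro h2
  have h1 := rho_pos h
  have h3 := rho_pos h2
  rw [rho_neg] at h3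
  omega

theorem act_mem_or {v : Fin n → ℤ} (h : v ∈ positiveRoots Φ n) (u : W n) :
    act u v ∈ positiveRoots Φ n ∨ -act u v ∈ positiveRoots Φ n := by
  obtain ⟨a, b, hab, rfl⟩ := mem_positiveRoots.mp h
  have hne : a ≠ b := by rintro rfl; simp at hab
  rw [act_root]
  have hne2 : u.1 a ≠ u.1 b := fun h => hne (u.injective h)
  rcases lt_trichotomy (height (u.1 b)) (height (u.1 a)) with h | h | h
  · exact Or.inl ((root_mem_positiveRoots hne2).mpr h)
  · exact absurd (height_inj.mp h).symm hne2
  · rw [← root_comm]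
    exact Or.inr ((root_mem_positiveRoots hne2.symm).mpr h)

theorem neg_act_mem {v : Fin n → ℤ} (h : v ∈ positiveRoots Φ n) {u : W n}
    (hu : act u v ∉ positiveRoots Φ n) : -act u v ∈ positiveRoots Φ n :=
  (act_mem_or h u).resolve_left hu

/-! ### Simple reflections -/

/-- The letter following `i`: `i + 1`, or `-i` for the last `i`. -/
def next (i : Fin n) : Letter n := if h : i.val + 1 < n then Sum.inl ⟨i.val + 1, h⟩ else Sum.inr i

theorem height_next_lt (i : Fin n) : height (next i) < height (Sum.inl i) := by
  unfold next
  split_ifs with h <;> simp; omega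

theorem simpleRoot_eq (i : Fin n) : simpleRoot Φ i = root Φ (Sum.inl i) (next i) := by
  unfold simpleRoot next
  split_ifs with h
  · simp [root]
  · simp [root]

theorem simpleRoot_mem (i : Fin n) : simpleRoot Φ i ∈ positiveRoots Φ n := by
  rw [simpleRoot_eq]
  exact mem_positiveRoots.mpr ⟨_, _, height_next_lt i, rfl⟩

/-- In terms of heights a simple reflection is a piecewise map on integers, so order questions about
letters become linear arithmetic. -/
theorem height_simple_of_lt {i : Fin n} (h : i.val + 1 < n) (x : Letter n) :
    height ((simpleReflection i).1 x) =
      if height x = n - i then (n : ℤ) - i - 1 else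
      if height x = n - i - 1 then (n : ℤ) - i else
      if height x = i - n then (i : ℤ) + 1 - n else
      if height x = i + 1 - n then (i : ℤ) - n else height x := by
  have hl (a b j : Fin n) : Equiv.swap (Sum.inr a : Letter n) (Sum.inr b) (Sum.inl j) = Sum.inl j :=
    Equiv.swap_apply_of_ne_of_ne (by simp) (by simp)
  have hr (a b j : Fin n) : Equiv.swap (Sum.inl a : Letter n) (Sum.inl b) (Sum.inr j) = Sum.inr j :=
    Equiv.swap_apply_of_ne_of_ne (by simp) (by simp)
  simp only [simpleReflection, simplePerm, dif_pos h, Equiv.Perm.mul_apply]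
  rcases x with j | j
  · rw [hl, Equiv.swap_apply_def]
    simp only [Sum.inl.injEq, Fin.ext_iff]
    split_ifs <;> simp only [height_inl] at * <;> push_cast at * <;> omega
  · rw [Equiv.swap_apply_def (Sum.inr i)]
    simp only [Sum.inr.injEq, Fin.ext_iff]
    split_ifs <;> rw [hr] <;> simp only [height_inr] at * <;> push_cast at * <;> omega

theorem height_simple_of_not_lt {i : Fin n} (h : ¬ i.val + 1 < n) (x : Letter n) :
    height ((simpleReflection i).1 x) =
      if height x = 1 then -1 else if height x = -1 then 1 else height x := by
  simp only [simpleReflection, simplePerm, dif_neg h]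
  rcases x with j | j
  · rw [Equiv.swap_apply_def]
    simp only [Sum.inl.injEq, Fin.ext_iff, reduceCtorEq, if_false]
    split_ifs <;> simp_all <;> omega
  · rw [Equiv.swap_apply_def]
    simp only [Sum.inr.injEq, Fin.ext_iff, reduceCtorEq, if_false]
    split_ifs <;> simp_all <;> omega

theorem simpleReflection_mul_self (i : Fin n) : simpleReflection i * simpleReflection i = 1 := by
  apply W.ext_inl
  intro j
  apply height_injective
  rw [W.mul_apply, W.one_apply]
  by_cases h : i.val + 1 < n
  · rw [height_simple_of_lt h, height_simple_of_lt h]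
    split_ifs <;> omega
  · rw [height_simple_of_not_lt h, height_simple_of_not_lt h]
    generalize height (Sum.inl j : Letter n) = a
    by_cases h1 : a = 1
    · simp [h1]
    · by_cases h2 : a = -1 <;> simp [h1, h2]

@[simp] theorem simpleReflection_inv (i : Fin n) : (simpleReflection i)⁻¹ = simpleReflection i :=
  inv_eq_of_mul_eq_one_left (simpleReflection_mul_self i)

@[simp] theorem mul_simple_mul_simple (u : W n) (i : Fin n) :
    u * simpleReflection i * simpleReflection i = u := by
  rw [mul_assoc, simpleReflection_mul_self, mul_one]

theorem simple_inl (i : Fin n) : (simpleReflection i).1 (Sum.inl i) = next i := by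
  unfold next
  by_cases h : i.val + 1 < n
  · simp only [simpleReflection, simplePerm, dif_pos h, Equiv.Perm.mul_apply]
    rw [Equiv.swap_apply_of_ne_of_ne (a := Sum.inr i) (by simp) (by simp), Equiv.swap_apply_left]
  · simp only [simpleReflection, simplePerm, dif_neg h]
    rw [Equiv.swap_apply_left]

theorem simple_next (i : Fin n) : (simpleReflection i).1 (next i) = Sum.inl i := by
  rw [← simple_inl, ← W.mul_apply, simpleReflection_mul_self, W.one_apply]

@[simp] theorem act_simple_simpleRoot (i : Fin n) :
    act (simpleReflection i) (simpleRoot Φ i) = -simpleRoot Φ i := by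
  rw [simpleRoot_eq, act_root, simple_inl, simple_next, root_comm]

theorem act_mul_simple_simpleRoot (u : W n) (i : Fin n) :
    act (u * simpleReflection i) (simpleRoot Φ i) = -act u (simpleRoot Φ i) := by
  rw [act_mul, act_simple_simpleRoot, act_neg]

/-- A simple reflection reverses the order of two letters only if they form its root. -/
theorem simple_order (i : Fin n) {a b : Letter n} (hab : height b < height a)
    (h : ¬ height ((simpleReflection i).1 b) < height ((simpleReflection i).1 a)) :
    (a = Sum.inl i ∧ b = next i) ∨ (a = (next i).swap ∧ b = Sum.inr i) := by
  have ha := height_le a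
  have hb := height_le b
  have ha' := neg_le_height a
  have hb' := neg_le_height b
  have ha0 := height_ne_zero a
  have hb0 := height_ne_zero b
  simp only [← height_inj]
  unfold next
  by_cases hi : i.val + 1 < n
  · rw [dif_pos hi]
    rw [height_simple_of_lt hi, height_simple_of_lt hi] at h
    simp only [height_inl, height_inr, height_swap]
    push_cast
    split_ifs at h <;> omega
  · rw [dif_neg hi]
    rw [height_simple_of_not_lt hi, height_simple_of_not_lt hi] at h
    simp only [height_inl, height_inr, height_swap]
    split_ifs at h <;> omega

theorem act_simple_mem {v : Fin n → ℤ} (h : v ∈ positiveRoots Φ n) {i : Fin n}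
    (hv : v ≠ simpleRoot Φ i) : act (simpleReflection i) v ∈ positiveRoots Φ n := by
  obtain ⟨a, b, hab, rfl⟩ := mem_positiveRoots.mp h
  have hne : a ≠ b := by rintro rfl; simp at hab
  rw [act_root, root_mem_positiveRoots fun h => hne ((simpleReflection i).injective h)]
  by_contra h2
  rcases simple_order i hab h2 with ⟨rfl, rfl⟩ | ⟨rfl, rfl⟩
  · exact hv (simpleRoot_eq i).symm
  · apply hv
    rw [simpleRoot_eq, ← root_swap_swap]; simp

/-! ### Reflections -/

theorem dotProduct_epsLetter (a b : Letter n) :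
    dotProduct (epsLetter a) (epsLetter b) = if a = b then 1 else if a = b.swap then -1 else 0 := by
  rcases a with i | i <;> rcases b with j | j <;>
    simp [eps, Pi.single_apply, eq_comm] <;> split_ifs <;> simp

theorem dotProduct_act (u : W n) (x y : Fin n → ℤ) :
    dotProduct (act u x) (act u y) = dotProduct x y := by
  have h (x y : Fin n → ℤ) (v : W n) : dotProduct (act v x) (act v y) =
      ∑ i, ∑ j, x i * (y j * dotProduct (epsLetter (Sum.inl i) : Fin n → ℤ)
        (epsLetter (Sum.inl j))) := by
    unfold act
    rw [sum_dotProduct]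
    refine Finset.sum_congr rfl fun i _ => ?_
    rw [dotProduct_sum]
    refine Finset.sum_congr rfl fun j _ => ?_
    simp only [smul_dotProduct, dotProduct_smul, dotProduct_epsLetter, smul_eq_mul,
      ← v.apply_swap, v.injective.eq_iff]
    ring
  rw [h x y u, ← h x y 1, act_one, act_one]

theorem simple_apply_of_ne {i : Fin n} {x : Letter n} (h1 : x ≠ Sum.inl i) (h2 : x ≠ Sum.inr i)
    (h3 : x ≠ next i) (h4 : x ≠ (next i).swap) : (simpleReflection i).1 x = x := by
  rw [← height_inj]
  rw [ne_eq, ← height_inj] at h1 h2 h3 h4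
  unfold next at h3 h4
  by_cases hi : i.val + 1 < n
  · rw [height_simple_of_lt hi]
    simp only [dif_pos hi, height_swap, height_inl, height_inr] at h1 h2 h3 h4
    push_cast at h1 h2 h3 h4
    split_ifs <;> omega
  · rw [height_simple_of_not_lt hi]
    simp only [dif_neg hi, height_swap, height_inl, height_inr] at h1 h2 h3 h4
    split_ifs <;> omega

/-- The usual reflection formula multiplied by `(α_i, α_i)`: it then makes sense over `ℤ` and is
uniform in both types. -/
theorem act_simpleReflection (i : Fin n) (x : Fin n → ℤ) :
    dotProduct (simpleRoot Φ i) (simpleRoot Φ i) • act (simpleReflection i) x =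
      dotProduct (simpleRoot Φ i) (simpleRoot Φ i) • x -
        (2 * dotProduct x (simpleRoot Φ i)) • simpleRoot Φ i := by
  have key (j : Fin n) :
      dotProduct (simpleRoot Φ i) (simpleRoot Φ i) • epsLetter ((simpleReflection i).1 (Sum.inl j)) =
      dotProduct (simpleRoot Φ i) (simpleRoot Φ i) • eps j -
        (2 * simpleRoot Φ i j) • simpleRoot Φ i := by
    by_cases hi : i.val + 1 < n
    · have hr : simpleRoot Φ i = eps i - eps ⟨i.val + 1, hi⟩ := by simp [simpleRoot, hi]
      have hnext : next i = Sum.inl ⟨i.val + 1, hi⟩ := by simp [next, hi]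
      have hne : (⟨i.val + 1, hi⟩ : Fin n) ≠ i := by simp [Fin.ext_iff]
      have h2 : dotProduct (simpleRoot Φ i) (simpleRoot Φ i) = 2 := by
        rw [hr]; simp [eps, hne, hne.symm]
      rw [h2, hr]
      by_cases h3 : j = i
      · subst h3
        rw [simple_inl, hnext]
        simp [eps, hne.symm]
        ring
      · by_cases h4 : j = ⟨i.val + 1, hi⟩
        · have := simple_next i
          rw [hnext] at this
          rw [h4, this]
          simp [eps, hne]
          ring
        · rw [simple_apply_of_ne (by simpa using h3) (by simp) (by simpa [hnext] using h4)
            (by simp [hnext])]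
          simp [eps, h3, h4]
    · have hr : simpleRoot Φ i = Φ.mult • eps i := by simp [simpleRoot, hi]
      have hnext : next i = Sum.inr i := by simp [next, hi]
      have h2 : dotProduct (simpleRoot Φ i) (simpleRoot Φ i) = Φ.mult * Φ.mult := by
        rw [hr, smul_dotProduct, dotProduct_smul]; simp [eps]
      rw [h2, hr]
      by_cases h3 : j = i
      · subst h3
        rw [simple_inl, hnext]
        ext k
        simp [eps]
        ring
      · rw [simple_apply_of_ne (by simpa using h3) (by simp) (by simp [hnext])
            (by simpa [hnext] using h3)]
        simp [eps, h3]
  have h1 : dotProduct x (simpleRoot Φ i) = ∑ j, x j * simpleRoot Φ i j := rfl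
  rw [act, h1, Finset.smul_sum]
  conv_rhs => enter [1]; rw [eq_sum_eps x]
  rw [Finset.smul_sum, Finset.mul_sum, Finset.sum_smul, ← Finset.sum_sub_distrib]
  refine Finset.sum_congr rfl fun j _ => ?_
  ext k
  have h := congrFun (key j) k
  simp only [Pi.smul_apply, Pi.sub_apply, smul_eq_mul] at h ⊢
  linear_combination x j * h

/-- The reflection in the root `g α_i`. -/
def reflection (g : W n) (i : Fin n) : W n := g * simpleReflection i * g⁻¹

theorem act_reflection (g : W n) (i : Fin n) (x : Fin n → ℤ) :
    dotProduct (act g (simpleRoot Φ i)) (act g (simpleRoot Φ i)) • act (reflection g i) x =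
      dotProduct (act g (simpleRoot Φ i)) (act g (simpleRoot Φ i)) • x -
        (2 * dotProduct x (act g (simpleRoot Φ i))) • act g (simpleRoot Φ i) := by
  have h := congrArg (act g) (act_simpleReflection (Φ := Φ) i (act g⁻¹ x))
  rw [act_sub, act_smul, act_smul, act_smul, act_act_inv, ← act_mul, ← act_mul] at h
  rw [dotProduct_act]
  rw [reflection, h, ← dotProduct_act g (act g⁻¹ x), act_act_inv]

theorem simpleRoot_ne_zero (i : Fin n) : simpleRoot Φ i ≠ 0 := by
  intro h
  have := rho_pos (simpleRoot_mem (Φ := Φ) i)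
  rw [h] at this
  simp [rho] at this

theorem act_simpleRoot_ne_zero (g : W n) (i : Fin n) : act g (simpleRoot Φ i) ≠ 0 := by
  intro h
  have := congrArg (act g⁻¹) h
  rw [act_inv_act] at this
  apply simpleRoot_ne_zero (Φ := Φ) i
  rw [this]
  simp [act]

/-- Proportional roots have the same reflection. -/
theorem reflection_eq {g g' : W n} {i i' : Fin n} {c d : ℤ} (hc : c ≠ 0)
    (h : c • act g (simpleRoot Φ i) = d • act g' (simpleRoot Φ i')) :
    reflection g i = reflection g' i' := by
  apply act_injective
  intro x
  have h1 := act_reflection (Φ := Φ) g i x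
  have h2 := act_reflection (Φ := Φ) g' i' x
  have h0 := act_simpleRoot_ne_zero (Φ := Φ) g i
  generalize act g (simpleRoot Φ i) = v at h h1 h0
  generalize act g' (simpleRoot Φ i') = v' at h h2
  have hN : c ^ 2 * dotProduct v v = d ^ 2 * dotProduct v' v' := by
    have := congrArg (fun y => dotProduct y y) h
    simp only [smul_dotProduct, dotProduct_smul, smul_eq_mul] at this
    linarith
  have hx : c * dotProduct x v = d * dotProduct x v' := by
    have := congrArg (fun y => dotProduct x y) h
    simpa only [dotProduct_smul, smul_eq_mul] using this
  have hv : dotProduct v v ≠ 0 := by rwa [ne_eq, dotProduct_self_eq_zero]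
  -- The two reflection formulas have the common multiplier `c² (v, v) = d² (v', v')`, which can be
  -- cancelled.
  have hne : c ^ 2 * dotProduct v v ≠ 0 := mul_ne_zero (pow_ne_zero 2 hc) hv
  ext k
  have e1 := congrFun h1 k
  have e2 := congrFun h2 k
  have e3 := congrFun h k
  simp only [Pi.smul_apply, Pi.sub_apply, smul_eq_mul] at e1 e2 e3
  apply mul_left_cancel₀ hne
  linear_combination c ^ 2 * e1 - d ^ 2 * e2 + (x k - act (reflection g' i') x k) * hN -
    2 * c * v k * hx - 2 * d * dotProduct x v' * e3

/-! ### Words and lengths -/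

@[simp] theorem wordProd_nil : wordProd ([] : List (Fin n)) = 1 := rfl

@[simp] theorem wordProd_cons (i : Fin n) (ω : List (Fin n)) :
    wordProd (i :: ω) = simpleReflection i * wordProd ω := by
  simp [wordProd]

theorem wordProd_append (ω ω' : List (Fin n)) :
    wordProd (ω ++ ω') = wordProd ω * wordProd ω' := by
  simp [wordProd]

theorem wordProd_reverse (ω : List (Fin n)) : wordProd ω.reverse = (wordProd ω)⁻¹ := by
  induction ω with
  | nil => simp
  | cons i ω ih => simp [wordProd_append, ih]

theorem length_le (ω : List (Fin n)) : length (wordProd ω) ≤ ω.length :=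
  Nat.sInf_le ⟨ω, rfl, rfl⟩

theorem length_inv (u : W n) : length u⁻¹ = length u := by
  have h (u : W n) : length u⁻¹ ≤ length u := by
    obtain ⟨ω, h1, h2⟩ := exists_isReducedExpr u
    rw [← h2, ← h1, ← wordProd_reverse, ← List.length_reverse]
    exact length_le _
  refine le_antisymm (h u) ?_
  simpa using h u⁻¹

/-- Strong exchange condition. Reading the word from the right, `v` turns negative at some letter
`i`; just before, its image must be `α_i`, because `s_i` keeps every other positive root positive.
Deleting that letter multiplies the word by the reflection in `v`. -/
theorem exchange (ω : List (Fin n)) {v : Fin n → ℤ} (hv : v ∈ positiveRoots Φ n)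
    (h : act (wordProd ω) v ∉ positiveRoots Φ n) :
    ∃ g i, v = act g (simpleRoot Φ i) ∧
      ∃ ω' : List (Fin n), ω'.length + 1 = ω.length ∧
        wordProd ω' = wordProd ω * reflection g i := by
  induction ω with
  | nil => simp [hv] at h
  | cons i ω ih =>
    by_cases h1 : act (wordProd ω) v ∈ positiveRoots Φ n
    · rw [wordProd_cons, act_mul] at h
      have h2 : act (wordProd ω) v = simpleRoot Φ i := by
        by_contra h2
        exact h (act_simple_mem h1 h2)
      refine ⟨(wordProd ω)⁻¹, i, by rw [← h2, act_inv_act], ω, by simp, ?_⟩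
      rw [reflection, wordProd_cons]
      simp only [inv_inv, mul_assoc, mul_inv_cancel_left]
      rw [← mul_assoc, simpleReflection_mul_self, one_mul]
    · obtain ⟨g, j, h2, ω', h3, h4⟩ := ih h1
      refine ⟨g, j, h2, i :: ω', by simp [h3], ?_⟩
      rw [wordProd_cons, wordProd_cons, h4, mul_assoc]

theorem length_mul_reflection_lt {u g : W n} {i : Fin n}
    (hv : act g (simpleRoot Φ i) ∈ positiveRoots Φ n)
    (h : act (u * g) (simpleRoot Φ i) ∉ positiveRoots Φ n) :
    length (u * reflection g i) < length u := by
  obtain ⟨ω, h1, h2⟩ := exists_isReducedExpr u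
  rw [act_mul, ← h1] at h
  obtain ⟨g', j, h3, ω', h4, h5⟩ := exchange ω hv h
  -- A root has many presentations `g α_i`, but its reflection depends on the root alone.
  have h6 : reflection g i = reflection g' j := by
    apply reflection_eq (Φ := Φ) (c := 1) (d := 1) one_ne_zero
    rw [h3]
  rw [h6, ← h1, ← h5]
  have := length_le ω'
  have : length (wordProd ω) = length u := by rw [h1]
  omega

theorem reflection_one (i : Fin n) : reflection 1 i = simpleReflection i := by
  simp [reflection]

theorem length_mul_simple_lt {u : W n} {i : Fin n}
    (h : act u (simpleRoot Φ i) ∉ positiveRoots Φ n) :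
    length (u * simpleReflection i) < length u := by
  rw [← reflection_one]
  refine length_mul_reflection_lt (Φ := Φ) ?_ ?_
  · rw [act_one]; exact simpleRoot_mem i
  · rwa [mul_one]

theorem length_mul_simple_le (u : W n) (i : Fin n) :
    length (u * simpleReflection i) ≤ length u + 1 := by
  obtain ⟨ω, h1, h2⟩ := exists_isReducedExpr u
  rw [← h2, ← h1]
  have := length_le (ω ++ [i])
  rw [wordProd_append] at this
  simpa using this

theorem act_mul_simple_notMem {u : W n} {i : Fin n}
    (h : act u (simpleRoot Φ i) ∈ positiveRoots Φ n) :
    act (u * simpleReflection i) (simpleRoot Φ i) ∉ positiveRoots Φ n := by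
  rw [act_mul_simple_simpleRoot]
  exact neg_notMem h

theorem act_mul_simple_mem {u : W n} {i : Fin n}
    (h : act u (simpleRoot Φ i) ∉ positiveRoots Φ n) :
    act (u * simpleReflection i) (simpleRoot Φ i) ∈ positiveRoots Φ n := by
  rw [act_mul_simple_simpleRoot]
  exact neg_act_mem (simpleRoot_mem i) h

theorem length_mul_simple {u : W n} {i : Fin n}
    (h : act u (simpleRoot Φ i) ∈ positiveRoots Φ n) :
    length (u * simpleReflection i) = length u + 1 := by
  have := length_mul_simple_lt (act_mul_simple_notMem h)
  have := length_mul_simple_le u i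
  rw [mul_simple_mul_simple] at *
  omega

@[simp] theorem length_one : length (1 : W n) = 0 := by
  simpa using length_le ([] : List (Fin n))

/-- If `i` is the first letter of a reduced word of `u⁻¹`, then `u s_i` is shorter than `u`, so `u
α_i` cannot be positive. -/
theorem exists_descent (Φ : BCType) {u : W n} (h : u ≠ 1) :
    ∃ i, act u (simpleRoot Φ i) ∉ positiveRoots Φ n := by
  obtain ⟨ω, h1, h2⟩ := exists_isReducedExpr u⁻¹
  rcases ω with _ | ⟨i, ω⟩
  · rw [wordProd_nil] at h1
    exact absurd (inv_eq_one.mp h1.symm) h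
  · refine ⟨i, fun h3 => ?_⟩
    have h4 := length_mul_simple h3
    have h5 : u * simpleReflection i = (wordProd ω)⁻¹ := by
      rw [← inv_inv u, ← h1, wordProd_cons, mul_inv_rev, simpleReflection_inv,
        mul_simple_mul_simple]
    rw [h5, length_inv] at h4
    have := length_le ω
    rw [length_inv, List.length_cons] at h2
    omega

/-- Induction along the right weak order. -/
theorem weak_induction (Φ : BCType) {P : W n → Prop} (one : P 1)
    (mul : ∀ u i, act u (simpleRoot Φ i) ∈ positiveRoots Φ n → P u → P (u * simpleReflection i))
    (u : W n) : P u := by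
  induction hk : length u using Nat.strong_induction_on generalizing u with
  | _ k ih =>
    by_cases h : u = 1
    · rwa [h]
    · obtain ⟨i, hi⟩ := exists_descent Φ h
      have h1 := length_mul_simple_lt hi
      have h2 := mul (u * simpleReflection i) i (act_mul_simple_mem hi)
        (ih _ (hk ▸ h1) _ rfl)
      rwa [mul_simple_mul_simple] at h2

/-- The longest element of the Weyl group, acting by `-1`. -/
def longest (n : ℕ) : W n := ⟨Equiv.sumComm _ _, fun _ => rfl⟩

@[simp] theorem act_longest (v : Fin n → ℤ) : act (longest n) v = -v := by
  have : act (longest n) v = ∑ i, v i • -eps i := rfl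
  conv_rhs => rw [eq_sum_eps v]
  rw [this, ← Finset.sum_neg_distrib]
  simp

/-- The longest element makes every positive root negative, so the exchange condition applies to
each of them. -/
theorem exists_eq_act_simpleRoot {v : Fin n → ℤ} (hv : v ∈ positiveRoots Φ n) :
    ∃ g i, v = act g (simpleRoot Φ i) := by
  obtain ⟨ω, hω⟩ := exists_wordProd_eq (longest n)
  obtain ⟨g, i, h, -⟩ := exchange ω hv (by rw [hω, act_longest]; exact neg_notMem hv)
  exact ⟨g, i, h⟩

/-- The positive roots which stay positive under `u⁻¹`. -/
def noninversions (Φ : BCType) (u : W n) : Finset (Fin n → ℤ) :=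
  (positiveRoots Φ n).filter fun v => act u⁻¹ v ∈ positiveRoots Φ n

theorem mem_noninversions {u : W n} {v : Fin n → ℤ} : v ∈ noninversions Φ u ↔
    v ∈ positiveRoots Φ n ∧ act u⁻¹ v ∈ positiveRoots Φ n := Finset.mem_filter

theorem notMem_noninversions_mul_simple (u : W n) (i : Fin n) :
    act u (simpleRoot Φ i) ∉ noninversions Φ (u * simpleReflection i) := by
  rw [mem_noninversions]
  rintro ⟨-, h⟩
  rw [mul_inv_rev, act_mul, act_inv_act, simpleReflection_inv, act_simple_simpleRoot] at h
  exact neg_notMem (simpleRoot_mem i) h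

/-- `s_i` permutes the positive roots other than `α_i`; only `u α_i` changes status between `u` and
`u s_i`. -/
theorem noninversions_eq_insert {u : W n} {i : Fin n}
    (h : act u (simpleRoot Φ i) ∈ positiveRoots Φ n) :
    noninversions Φ u =
      insert (act u (simpleRoot Φ i)) (noninversions Φ (u * simpleReflection i)) := by
  ext v
  rw [Finset.mem_insert, mem_noninversions, mem_noninversions, mul_inv_rev, act_mul,
    simpleReflection_inv]
  constructor
  · rintro ⟨h1, h2⟩
    by_cases h3 : act u⁻¹ v = simpleRoot Φ i
    · left
      rw [← h3, act_act_inv]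
    · exact Or.inr ⟨h1, act_simple_mem h2 h3⟩
  · rintro (rfl | ⟨h1, h2⟩)
    · exact ⟨h, by rw [act_inv_act]; exact simpleRoot_mem i⟩
    · refine ⟨h1, ?_⟩
      have h3 := act_simple_mem (i := i) h2 (by
        intro h3
        have h4 := congrArg (act (simpleReflection i)) h3
        rw [← act_mul, simpleReflection_mul_self, act_one, act_simple_simpleRoot] at h4
        have h5 := congrArg (act u) h4
        rw [act_act_inv, act_neg] at h5
        rw [h5] at h1
        exact neg_notMem h h1)
      rwa [← act_mul, simpleReflection_mul_self, act_one] at h3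

theorem noninversions_one : noninversions Φ (1 : W n) = positiveRoots Φ n := by
  ext v
  simp [mem_noninversions]

theorem card_noninversions (u : W n) :
    (noninversions Φ u).card + length u = (positiveRoots Φ n).card := by
  induction u using weak_induction Φ with
  | one => simp [noninversions_one]
  | mul u i h ih =>
    rw [length_mul_simple h, ← ih, noninversions_eq_insert h,
      Finset.card_insert_of_notMem (notMem_noninversions_mul_simple u i)]
    ring

theorem length_le_card (Φ : BCType) (u : W n) : length u ≤ (positiveRoots Φ n).card := by
  rw [← card_noninversions u]
  omega

theorem longest_inv : (longest n)⁻¹ = longest n :=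
  inv_eq_of_mul_eq_one_left (Subtype.ext (by ext x; simp [longest]))

theorem noninversions_longest : noninversions Φ (longest n) = ∅ := by
  rw [Finset.eq_empty_iff_forall_notMem]
  intro v hv
  rw [mem_noninversions, longest_inv, act_longest] at hv
  exact neg_notMem hv.1 hv.2

/-- Composing `u` with `-1` leaves no descent, so `u` is the longest element. -/
theorem length_eq_card {u : W n} (h : ∀ i, act u (simpleRoot Φ i) ∉ positiveRoots Φ n) :
    length u = (positiveRoots Φ n).card := by
  have h1 : u * longest n = 1 := by
    by_contra h2
    obtain ⟨i, hi⟩ := exists_descent Φ h2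
    rw [act_mul, act_longest, act_neg] at hi
    exact hi (neg_act_mem (simpleRoot_mem i) (h i))
  have h2 : u = longest n := by
    rw [← longest_inv]
    exact eq_inv_of_mul_eq_one_left h1
  rw [← card_noninversions u, h2, noninversions_longest]
  simp

/-! ### Linear forms -/

open MvPolynomial

theorem linForm_add (x y : Fin n → ℤ) : linForm (x + y) = linForm x + linForm y := by
  simp [linForm, add_mul, Finset.sum_add_distrib]

theorem linForm_neg (x : Fin n → ℤ) : linForm (-x) = -linForm x := by
  simp [linForm]

theorem linForm_sub (x y : Fin n → ℤ) : linForm (x - y) = linForm x - linForm y := by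
  rw [sub_eq_add_neg, linForm_add, linForm_neg, sub_eq_add_neg]

theorem linForm_smul (c : ℤ) (x : Fin n → ℤ) : linForm (c • x) = C (c : ℂ) * linForm x := by
  simp [linForm, Finset.mul_sum, mul_assoc]

theorem coeff_linForm (v : Fin n → ℤ) (i : Fin n) :
    coeff (Finsupp.single i 1) (linForm v) = v i := by
  rw [linForm, coeff_sum, Finset.sum_eq_single i]
  · rw [coeff_C_mul, coeff_X, if_pos rfl, mul_one]
  · intro j _ hj
    rw [coeff_C_mul, coeff_X, if_neg, mul_zero]
    rwa [Finsupp.single_left_inj one_ne_zero]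
  · simp

theorem linForm_ne_zero {v : Fin n → ℤ} (hv : v ≠ 0) : linForm v ≠ 0 := by
  intro h
  apply hv
  ext i
  have := coeff_linForm v i
  rw [h, coeff_zero] at this
  exact_mod_cast this.symm

theorem linForm_isHomogeneous (v : Fin n → ℤ) : (linForm v).IsHomogeneous 1 := by
  refine IsHomogeneous.sum _ _ _ fun i _ => ?_
  simpa using (isHomogeneous_C _ (v i : ℂ)).mul (isHomogeneous_X ℂ i)

theorem totalDegree_linForm {v : Fin n → ℤ} (hv : v ≠ 0) : (linForm v).totalDegree = 1 :=
  (linForm_isHomogeneous v).totalDegree (linForm_ne_zero hv)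

theorem linForm_prime {v : Fin n → ℤ} (hv : v ≠ 0) : Prime (linForm v) := by
  refine (irreducible_of_totalDegree_eq_one (totalDegree_linForm hv) fun x hx => ?_).prime
  rw [isUnit_iff_ne_zero]
  rintro rfl
  apply linForm_ne_zero hv
  ext m
  simpa using hx m

/-- Both forms have degree at most one, so the quotient is a constant. Comparing coefficients at an
`i` with `v i ≠ 0` shows that the integers `v i` and `a i` serve as multipliers. -/
theorem proportional_of_linForm_dvd {v a : Fin n → ℤ} (hv : v ≠ 0)
    (h : linForm v ∣ linForm a) : ∃ c d : ℤ, c ≠ 0 ∧ c • a = d • v := by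
  obtain ⟨i, hi⟩ := Function.ne_iff.mp hv
  refine ⟨v i, a i, hi, ?_⟩
  by_cases ha : a = 0
  · simp [ha]
  obtain ⟨q, hq⟩ := h
  have hq0 : q ≠ 0 := by
    rintro rfl
    rw [mul_zero] at hq
    exact linForm_ne_zero ha hq
  have hd := congrArg totalDegree hq
  rw [totalDegree_mul_of_isDomain (linForm_ne_zero hv) hq0, totalDegree_linForm hv,
    totalDegree_linForm ha] at hd
  rw [totalDegree_eq_zero_iff_eq_C.mp (by omega : q.totalDegree = 0)] at hq
  have hc (j : Fin n) := congrArg (coeff (Finsupp.single j 1)) hq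
  simp only [mul_comm (linForm v), coeff_C_mul, coeff_linForm] at hc
  ext j
  simp only [Pi.smul_apply, smul_eq_mul]
  have : (v i : ℂ) * a j = a i * v j := by rw [hc j, hc i]; ring
  exact_mod_cast this

/-! ### Proportional positive roots and products of linear forms. -/

theorem dotProduct_self_of_mem {v : Fin n → ℤ} (h : v ∈ positiveRoots Φ n) :
    dotProduct v v = 2 ∨ dotProduct v v = Φ.mult * Φ.mult := by
  obtain ⟨a, b, hab, rfl⟩ := mem_positiveRoots.mp h
  have hne : a ≠ b := by rintro rfl; simp at hab
  by_cases hb : b = a.swap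
  · right
    rw [root, if_pos hb, smul_dotProduct, dotProduct_smul, dotProduct_epsLetter]
    simp
  · left
    have hb' : a ≠ b.swap := by rintro rfl; simp at hb
    rw [root, if_neg hb, sub_dotProduct, dotProduct_sub, dotProduct_sub]
    simp [dotProduct_epsLetter, hne, hne.symm, hb, hb']

/-- Proportional roots attain equality in Cauchy–Schwarz, so the product of their squared lengths is
a perfect square. Short and long roots would give `2` or `8`; hence the lengths agree, the ratio is
`±1`, and positivity excludes `-1`. -/
theorem eq_of_proportional {v a : Fin n → ℤ} (hv : v ∈ positiveRoots Φ n)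
    (ha : a ∈ positiveRoots Φ n) {c d : ℤ} (hc : c ≠ 0) (h : c • a = d • v) : a = v := by
  have h1 : c * dotProduct a a = d * dotProduct a v := by
    have := congrArg (dotProduct a) h
    simpa only [dotProduct_smul, smul_eq_mul] using this
  have h2 : c * dotProduct a v = d * dotProduct v v := by
    have := congrArg (fun x => dotProduct x v) h
    simpa only [smul_dotProduct, smul_eq_mul] using this
  have h3 : dotProduct a a * dotProduct v v = dotProduct a v ^ 2 := by
    apply mul_left_cancel₀ hc
    linear_combination dotProduct v v * h1 - dotProduct a v * h2
  have hsq (k x : ℤ) (hk : k = 2 ∨ k = 8) : k ≠ x ^ 2 := by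
    intro hx
    have : x < 3 := by rcases hk with hk | hk <;> nlinarith
    have : -3 < x := by rcases hk with hk | hk <;> nlinarith
    interval_cases x <;> omega
  have h4 : dotProduct a a = dotProduct v v ∧ dotProduct v v ≠ 0 := by
    rcases dotProduct_self_of_mem ha with h5 | h5 <;> rcases dotProduct_self_of_mem hv with h6 | h6
    · exact ⟨by rw [h5, h6], by rw [h6]; norm_num⟩
    · refine absurd h3 (hsq _ _ ?_)
      rw [h5, h6]
      cases Φ <;> simp [BCType.mult]
    · refine absurd h3 (hsq _ _ ?_)
      rw [h5, h6]
      cases Φ <;> simp [BCType.mult]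
    · refine ⟨by rw [h5, h6], ?_⟩
      rw [h6]
      exact mul_ne_zero Φ.mult_pos.ne' Φ.mult_pos.ne'
  rw [h4.1] at h1 h3
  rw [← sq, eq_comm, sq_eq_sq_iff_eq_or_eq_neg] at h3
  rcases h3 with h3 | h3
  · rw [h3] at h1
    rw [← mul_right_cancel₀ h4.2 h1] at h
    exact smul_right_injective _ hc h
  · rw [h3, mul_neg, ← neg_mul] at h1
    rw [mul_right_cancel₀ h4.2 h1, neg_smul, ← smul_neg] at h
    have hd : d ≠ 0 := by
      rintro rfl
      exact hc (by simpa using mul_right_cancel₀ h4.2 h1)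
    have h7 : a = -v := by
      have : d • a = d • -v := by
        rw [smul_neg, ← h, smul_neg, neg_neg]
      exact smul_right_injective _ hd this
    rw [h7] at ha
    exact absurd ha (neg_notMem hv)

theorem eq_of_linForm_dvd {v a : Fin n → ℤ} (hv : v ∈ positiveRoots Φ n)
    (ha : a ∈ positiveRoots Φ n) (h : linForm v ∣ linForm a) : a = v := by
  have hv0 : v ≠ 0 := by
    rintro rfl
    simpa [rho] using rho_pos hv
  obtain ⟨c, d, hc, h⟩ := proportional_of_linForm_dvd hv0 h
  exact eq_of_proportional hv ha hc h

theorem ne_zero_of_mem {v : Fin n → ℤ} (hv : v ∈ positiveRoots Φ n) : v ≠ 0 := by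
  rintro rfl
  simpa [rho] using rho_pos hv

theorem prod_linForm_dvd {s : Finset (Fin n → ℤ)} (hs : s ⊆ positiveRoots Φ n) {p : PolyRing n}
    (h : ∀ v ∈ s, linForm v ∣ p) : ∏ v ∈ s, linForm v ∣ p := by
  refine Finset.prod_dvd_of_isRelPrime (fun v hv a ha hva => ?_) h
  refine ((linForm_prime (ne_zero_of_mem (hs hv))).irreducible.isRelPrime_iff_not_dvd).mpr ?_
  intro h1
  exact hva (eq_of_linForm_dvd (hs hv) (hs ha) h1).symm

theorem totalDegree_prod_linForm {s : Finset (Fin n → ℤ)} (hs : s ⊆ positiveRoots Φ n) :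
    (∏ v ∈ s, linForm v).totalDegree = s.card := by
  have h : (∏ v ∈ s, linForm v).IsHomogeneous (∑ _v ∈ s, 1) :=
    IsHomogeneous.prod _ _ _ fun v _ => linForm_isHomogeneous v
  rw [h.totalDegree]
  · simp
  · exact Finset.prod_ne_zero_iff.mpr fun v hv => linForm_ne_zero (ne_zero_of_mem (hs hv))

/-- `x - s_β x` is a multiple of `β` up to the factor `(β, β)`, which is a unit over `ℂ`. -/
theorem linForm_dvd_reflection (g : W n) (i : Fin n) (x : Fin n → ℤ) :
    linForm (act g (simpleRoot Φ i)) ∣ linForm x - linForm (act (reflection g i) x) := by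
  have h := congrArg linForm (act_reflection (Φ := Φ) g i x)
  have hN : (dotProduct (act g (simpleRoot Φ i)) (act g (simpleRoot Φ i)) : ℤ) ≠ 0 := by
    rw [ne_eq, dotProduct_self_eq_zero]
    exact act_simpleRoot_ne_zero g i
  rw [linForm_sub, linForm_smul, linForm_smul, linForm_smul] at h
  have hu : IsUnit (C ((dotProduct (act g (simpleRoot Φ i)) (act g (simpleRoot Φ i)) : ℤ) : ℂ) :
      PolyRing n) := by
    refine IsUnit.map C (isUnit_iff_ne_zero.mpr ?_)
    exact_mod_cast hN
  rw [← hu.dvd_mul_left, mul_sub, h, sub_sub_cancel]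
  exact dvd_mul_left _ _

/-! ### Families of polynomials satisfying congruences along roots -/

/-- A family of polynomials indexed by the Weyl group such that the members at `u` and `s_β u`
are congruent modulo `β`, for every root `β`. -/
def IsGKM (Φ : BCType) (p : W n → PolyRing n) : Prop :=
  ∀ u g i, linForm (act g (simpleRoot Φ i)) ∣ p u - p (reflection g i * u)

open Classical in
/-- The divided difference `(p u - p (u s_i)) / (u α_i)`. -/
noncomputable def dividedDifference (Φ : BCType) (i : Fin n) (p : W n → PolyRing n) (u : W n) :
    PolyRing n :=
  if h : linForm (act u (simpleRoot Φ i)) ∣ p u - p (u * simpleReflection i) then h.choose else 0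

theorem reflection_mul_self (u : W n) (i : Fin n) :
    reflection u i * u = u * simpleReflection i := by
  simp [reflection]

theorem IsGKM.dividedDifference_spec {p : W n → PolyRing n} (hp : IsGKM Φ p) (i : Fin n) (u : W n) :
    linForm (act u (simpleRoot Φ i)) * dividedDifference Φ i p u =
      p u - p (u * simpleReflection i) := by
  have h := hp u u i
  rw [reflection_mul_self] at h
  rw [dividedDifference, dif_pos h]
  exact h.choose_spec.symm

theorem IsGKM.dividedDifference_mul_simple {p : W n → PolyRing n} (hp : IsGKM Φ p) (i : Fin n)
    (u : W n) : dividedDifference Φ i p (u * simpleReflection i) = dividedDifference Φ i p u := by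
  have h1 := hp.dividedDifference_spec i u
  have h2 := hp.dividedDifference_spec i (u * simpleReflection i)
  rw [mul_simple_mul_simple, act_mul_simple_simpleRoot, linForm_neg] at h2
  apply mul_left_cancel₀ (linForm_ne_zero (act_simpleRoot_ne_zero (Φ := Φ) u i))
  linear_combination -h1 - h2

/-- If `β` divides `u α_i`, the two are proportional, so `s_β u = u s_i` and the two values
coincide. Otherwise the prime `β` may be tested after multiplying by `u α_i`. -/
theorem IsGKM.dividedDifference {p : W n → PolyRing n} (hp : IsGKM Φ p) (i : Fin n) :
    IsGKM Φ (dividedDifference Φ i p) := by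
  intro u g j
  by_cases h : linForm (act g (simpleRoot Φ j)) ∣ linForm (act u (simpleRoot Φ i))
  · obtain ⟨c, d, hc, h1⟩ := proportional_of_linForm_dvd (act_simpleRoot_ne_zero g j) h
    rw [← reflection_eq hc h1, reflection_mul_self, hp.dividedDifference_mul_simple, sub_self]
    exact dvd_zero _
  · refine ((linForm_prime (act_simpleRoot_ne_zero g j)).dvd_or_dvd ?_).resolve_left h
    have h1 := hp.dividedDifference_spec i u
    have h2 := hp.dividedDifference_spec i (reflection g j * u)
    have h3 := hp u g j
    have h4 := hp (u * simpleReflection i) g j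
    have h5 := linForm_dvd_reflection (Φ := Φ) g j (act u (simpleRoot Φ i))
    rw [← act_mul] at h5
    rw [← mul_assoc] at h4
    -- A Leibniz rule: `β` divides the differences of `p` by hypothesis, and `u α_i - s_β u α_i`
    -- since it is a multiple of `β`.
    have h6 : linForm (act u (simpleRoot Φ i)) * (KostantKumar.dividedDifference Φ i p u -
        KostantKumar.dividedDifference Φ i p (reflection g j * u)) =
        (p u - p (reflection g j * u)) - (p (u * simpleReflection i) -
          p (reflection g j * u * simpleReflection i)) -
        (linForm (act u (simpleRoot Φ i)) - linForm (act (reflection g j * u) (simpleRoot Φ i))) *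
          KostantKumar.dividedDifference Φ i p (reflection g j * u) := by
      linear_combination h1 - h2
    rw [h6]
    exact dvd_sub (dvd_sub h3 h4) (Dvd.dvd.mul_right h5 _)

theorem IsGKM.sub {p q : W n → PolyRing n} (hp : IsGKM Φ p) (hq : IsGKM Φ q) :
    IsGKM Φ (p - q) := by
  intro u g i
  have := dvd_sub (hp u g i) (hq u g i)
  rwa [show (p - q) u - (p - q) (reflection g i * u) =
    p u - p (reflection g i * u) - (q u - q (reflection g i * u)) by
      simp only [Pi.sub_apply]; ring]

theorem linForm_dvd_prod (g : W n) (i : Fin n) :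
    linForm (act g (simpleRoot Φ i)) ∣ ∏ v ∈ positiveRoots Φ n, linForm v := by
  rcases act_mem_or (simpleRoot_mem (Φ := Φ) i) g with h | h
  · exact Finset.dvd_prod_of_mem _ h
  · rw [← neg_neg (act g _), linForm_neg, neg_dvd]
    exact Finset.dvd_prod_of_mem _ h

open Classical in
/-- The iterated divided differences of the family `∏_{α > 0} α` supported at the identity. -/
noncomputable def wordFamily (Φ : BCType) {n : ℕ} : List (Fin n) → W n → PolyRing n
  | [] => fun u => if u = 1 then ∏ v ∈ positiveRoots Φ n, linForm v else 0
  | i :: ω => dividedDifference Φ i (wordFamily Φ ω)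

theorem wordFamily_isGKM (ω : List (Fin n)) : IsGKM Φ (wordFamily Φ ω) := by
  induction ω with
  | nil =>
    intro u g i
    refine dvd_sub ?_ ?_ <;>
    · unfold wordFamily
      split_ifs
      · exact linForm_dvd_prod g i
      · exact dvd_zero _
  | cons i ω ih => exact ih.dividedDifference i

theorem wordFamily_cons (i : Fin n) (ω : List (Fin n)) (u : W n) :
    linForm (act u (simpleRoot Φ i)) * wordFamily Φ (i :: ω) u =
      wordFamily Φ ω u - wordFamily Φ ω (u * simpleReflection i) :=
  (wordFamily_isGKM ω).dividedDifference_spec i u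

/-- The initial product has degree `|Φ⁺|`, and each division lowers the degree by one. The zero
polynomial is kept apart because its `totalDegree` is `0`. -/
theorem totalDegree_wordFamily (ω : List (Fin n)) (u : W n) :
    wordFamily Φ ω u = 0 ∨
      (wordFamily Φ ω u).totalDegree + ω.length ≤ (positiveRoots Φ n).card := by
  induction ω generalizing u with
  | nil =>
    unfold wordFamily
    split_ifs
    · right
      rw [totalDegree_prod_linForm subset_rfl]; simp
    · exact Or.inl rfl
  | cons i ω ih =>
    by_cases h0 : wordFamily Φ (i :: ω) u = 0
    · exact Or.inl h0
    right
    have h := wordFamily_cons (Φ := Φ) i ω u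
    have hα := act_simpleRoot_ne_zero (Φ := Φ) u i
    have hd := totalDegree_mul_of_isDomain (linForm_ne_zero hα) h0
    rw [totalDegree_linForm hα, h] at hd
    have hne : wordFamily Φ ω u - wordFamily Φ ω (u * simpleReflection i) ≠ 0 := by
      rw [← h]
      exact mul_ne_zero (linForm_ne_zero hα) h0
    have hs := totalDegree_sub (wordFamily Φ ω u) (wordFamily Φ ω (u * simpleReflection i))
    have h1 := ih u
    have h2 := ih (u * simpleReflection i)
    rw [List.length_cons]
    rcases h1 with h1 | h1 <;> rcases h2 with h2 | h2
    · simp [h1, h2] at hne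
    · rw [h1] at hs hd; rw [totalDegree_zero] at hs; omega
    · rw [h2] at hs hd; rw [totalDegree_zero] at hs; omega
    · omega

/-- The new value at `u` only involves the old ones at `u` and `u s_i`, so each letter extends the
support by at most one in length. -/
theorem wordFamily_support (ω : List (Fin n)) (u : W n) (h : wordFamily Φ ω u ≠ 0) :
    u = (wordProd ω)⁻¹ ∨ length u < ω.length := by
  induction ω generalizing u with
  | nil =>
    unfold wordFamily at h
    split_ifs at h with h1
    · simp [h1]
    · exact absurd rfl h
  | cons i ω ih =>
    have h1 := wordFamily_cons (Φ := Φ) i ω u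
    have hα := linForm_ne_zero (act_simpleRoot_ne_zero (Φ := Φ) u i)
    have hl : length (wordProd ω)⁻¹ ≤ ω.length := by
      rw [length_inv]; exact length_le ω
    rw [List.length_cons, wordProd_cons, mul_inv_rev, simpleReflection_inv]
    by_cases h2 : wordFamily Φ ω u = 0
    · have h3 : wordFamily Φ ω (u * simpleReflection i) ≠ 0 := by
        intro h3
        rw [h2, h3, sub_zero] at h1
        exact mul_ne_zero hα h h1
      rcases ih _ h3 with h4 | h4
      · left
        rw [← h4, mul_simple_mul_simple]
      · right
        have := length_mul_simple_le (u * simpleReflection i) i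
        rw [mul_simple_mul_simple] at this
        omega
    · right
      rcases ih u h2 with h4 | h4
      · rw [h4]; omega
      · omega

/-! ### Independence of the reduced word -/

/-- At the top of the support only one of the two terms survives, and dividing by it removes
precisely the root that leaves the set of noninversions. -/
theorem wordFamily_top (ω : List (Fin n)) (h : ω.length = length (wordProd ω)) :
    wordFamily Φ ω (wordProd ω)⁻¹ = ∏ v ∈ noninversions Φ (wordProd ω)⁻¹, linForm v := by
  induction ω with
  | nil => simp [wordFamily, noninversions_one]
  | cons i ω ih =>
    have hl : length (wordProd (i :: ω))⁻¹ = length (wordProd (i :: ω)) := length_inv _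
    have hu : (wordProd (i :: ω))⁻¹ = (wordProd ω)⁻¹ * simpleReflection i := by
      rw [wordProd_cons, mul_inv_rev, simpleReflection_inv]
    have hle := length_le ω
    have hle2 := length_mul_simple_le (wordProd ω)⁻¹ i
    rw [← hu, hl, ← h, length_inv, List.length_cons] at hle2
    have hpos : act (wordProd ω)⁻¹ (simpleRoot Φ i) ∈ positiveRoots Φ n := by
      by_contra h1
      have := length_mul_simple_lt h1
      rw [← hu, hl, ← h, length_inv, List.length_cons] at this
      omega
    have ih := ih (by omega)
    rw [noninversions_eq_insert hpos,
      Finset.prod_insert (notMem_noninversions_mul_simple _ _), ← hu] at ih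
    have h2 := wordFamily_cons (Φ := Φ) i ω (wordProd (i :: ω))⁻¹
    have h3 : wordFamily Φ ω (wordProd (i :: ω))⁻¹ = 0 := by
      by_contra h3
      rw [List.length_cons] at h
      rcases wordFamily_support _ _ h3 with h4 | h4
      · rw [h4, length_inv] at hl
        omega
      · omega
    rw [h3, zero_sub, hu, mul_simple_mul_simple, act_mul_simple_simpleRoot, ← hu, linForm_neg,
      ih, neg_mul, neg_inj] at h2
    exact mul_left_cancel₀ (linForm_ne_zero (act_simpleRoot_ne_zero _ _)) h2

/-- Suppose the families differ and take `u` of maximal length where they do. Their top values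
agree, so `u` is shorter than the words. The congruences make the difference at `u` divisible by all
`|Φ⁺| - l(u)` roots whose reflections lengthen `u`, but its degree is at most `|Φ⁺| - l(w)`, which
is smaller. -/
theorem wordFamily_eq {ω ω' : List (Fin n)} (h : ω.length = length (wordProd ω))
    (h' : ω'.length = length (wordProd ω')) (hω : wordProd ω = wordProd ω') :
    wordFamily Φ ω = wordFamily Φ ω' := by
  by_contra hne
  obtain ⟨u₀, hu₀⟩ := Function.ne_iff.mp hne
  -- Minimising `|Φ⁺| - l(u)` selects a longest `u` at which the families differ.
  have hex : ∃ k, ∃ u, wordFamily Φ ω u ≠ wordFamily Φ ω' u ∧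
      (positiveRoots Φ n).card - length u = k := ⟨_, u₀, hu₀, rfl⟩
  classical
  obtain ⟨u, hu, huk⟩ := Nat.find_spec hex
  have hmax (v : W n) (hv : length u < length v) : wordFamily Φ ω v = wordFamily Φ ω' v := by
    by_contra h1
    have h2 := Nat.find_min hex (m := (positiveRoots Φ n).card - length v)
      (by rw [← huk]; have := length_le_card Φ v; omega)
    exact h2 ⟨v, h1, rfl⟩
  have hll : ω.length = ω'.length := by rw [h, h', hω]
  have hlen : length u < ω.length := by
    by_contra h1
    have h2 (ω'' : List (Fin n)) (hl : ω.length = ω''.length)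
        (h3 : u ≠ (wordProd ω'')⁻¹) : wordFamily Φ ω'' u = 0 := by
      by_contra h4
      rcases wordFamily_support _ _ h4 with h4 | h4
      · exact h3 h4
      · omega
    by_cases h3 : u = (wordProd ω)⁻¹
    · apply hu
      rw [h3, wordFamily_top ω h]
      rw [hω, wordFamily_top ω' h']
    · apply hu
      rw [h2 ω rfl h3, h2 ω' hll (by rwa [← hω])]
  have hgkm := (wordFamily_isGKM (Φ := Φ) ω).sub (wordFamily_isGKM ω')
  have hdvd : ∏ v ∈ noninversions Φ u, linForm v ∣ wordFamily Φ ω u - wordFamily Φ ω' u := by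
    refine prod_linForm_dvd (Φ := Φ) (Finset.filter_subset _ _) fun v hv => ?_
    obtain ⟨h1, h2⟩ := mem_noninversions.mp hv
    obtain ⟨g, i, rfl⟩ := exists_eq_act_simpleRoot h1
    have h3 := hgkm u g i
    have h4 : length u < length (reflection g i * u) := by
      have hr : reflection g i * reflection g i = 1 := by
        simp only [reflection, mul_assoc, inv_mul_cancel_left]
        rw [← mul_assoc (simpleReflection i), simpleReflection_mul_self, one_mul, mul_inv_cancel]
      -- The length criterion is for multiplication on the right, so it is applied to `(s_β u)⁻¹ =
      -- u⁻¹ s_β`.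
      have h5 := length_mul_reflection_lt (u := u⁻¹ * reflection g i) (g := g) (i := i) h1 (by
        have : u⁻¹ * reflection g i * g = u⁻¹ * (g * simpleReflection i) := by
          simp [reflection, mul_assoc]
        rw [this, act_mul, act_mul_simple_simpleRoot, act_neg]
        exact neg_notMem h2)
      rw [mul_assoc, hr, mul_one, length_inv] at h5
      have hri : (reflection g i)⁻¹ = reflection g i := inv_eq_of_mul_eq_one_left hr
      rwa [← length_inv (u⁻¹ * reflection g i), mul_inv_rev, inv_inv, hri] at h5
    rwa [Pi.sub_apply, Pi.sub_apply, hmax _ h4, sub_self, sub_zero] at h3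
  have hsub : noninversions Φ u ⊆ positiveRoots Φ n := Finset.filter_subset _ _
  have hne0 : wordFamily Φ ω u - wordFamily Φ ω' u ≠ 0 := sub_ne_zero.mpr hu
  have hdeg := totalDegree_le_of_dvd_of_isDomain hdvd hne0
  rw [totalDegree_prod_linForm hsub] at hdeg
  have hcard := card_noninversions (Φ := Φ) u
  have hs := totalDegree_sub (wordFamily Φ ω u) (wordFamily Φ ω' u)
  have hle := length_le_card Φ (wordProd ω)
  have h1 := totalDegree_wordFamily (Φ := Φ) ω u
  have h2 := totalDegree_wordFamily (Φ := Φ) ω' u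
  have h3 (p : PolyRing n) (hp : p = 0 ∨ p.totalDegree + ω.length ≤ (positiveRoots Φ n).card) :
      p.totalDegree + ω.length ≤ (positiveRoots Φ n).card := by
    rcases hp with rfl | hp
    · rw [totalDegree_zero]; omega
    · exact hp
  rw [← hll] at h2
  have := h3 _ h1
  have := h3 _ h2
  omega

/-- The family `u ↦ ± c_{w,u} ∏_{α > 0} α`. -/
noncomputable def kkFamily (Φ : BCType) (w : W n) : W n → PolyRing n :=
  wordFamily Φ (reducedExpr w⁻¹)

theorem reducedExpr_spec (w : W n) : IsReducedExpr w (reducedExpr w) :=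
  (exists_isReducedExpr w).choose_spec

theorem wordFamily_eq_kkFamily {ω : List (Fin n)} (h : ω.length = length (wordProd ω)) :
    wordFamily Φ ω = kkFamily Φ (wordProd ω)⁻¹ := by
  obtain ⟨h1, h2⟩ := reducedExpr_spec (wordProd ω)
  rw [kkFamily, inv_inv]
  exact wordFamily_eq h (by rw [h1, h2]) h1.symm

theorem kkFamily_support {w u : W n} (h : kkFamily Φ w u ≠ 0) : u = w ∨ length u < length w := by
  obtain ⟨h1, h2⟩ := reducedExpr_spec w⁻¹
  have := wordFamily_support _ _ h
  rwa [h1, h2, inv_inv, length_inv] at this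

theorem kkFamily_self (w : W n) : kkFamily Φ w w = ∏ v ∈ noninversions Φ w, linForm v := by
  obtain ⟨h1, h2⟩ := reducedExpr_spec w⁻¹
  have := wordFamily_top (Φ := Φ) (reducedExpr w⁻¹) (by rw [h1, h2])
  rwa [h1, inv_inv] at this

theorem kkFamily_one_of_ne {u : W n} (h : u ≠ 1) : kkFamily Φ 1 u = 0 := by
  by_contra h1
  rcases kkFamily_support h1 with h2 | h2
  · exact h h2
  · simp at h2

/-- Independence of the reduced word allows prepending `i` to the chosen word of `w⁻¹`, whatever
word was chosen for `(w s_i)⁻¹`. -/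
theorem kkFamily_mul_simple {w : W n} {i : Fin n}
    (h : act w (simpleRoot Φ i) ∈ positiveRoots Φ n) (u : W n) :
    linForm (act u (simpleRoot Φ i)) * kkFamily Φ (w * simpleReflection i) u =
      kkFamily Φ w u - kkFamily Φ w (u * simpleReflection i) := by
  obtain ⟨h1, h2⟩ := reducedExpr_spec w⁻¹
  have h3 : wordProd (i :: reducedExpr w⁻¹) = (w * simpleReflection i)⁻¹ := by
    rw [wordProd_cons, h1, mul_inv_rev, simpleReflection_inv]
  have h4 := wordFamily_eq_kkFamily (Φ := Φ) (ω := i :: reducedExpr w⁻¹) (by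
    rw [h3, length_inv, length_mul_simple h, List.length_cons, h2, length_inv])
  rw [h3, inv_inv] at h4
  rw [← h4, wordFamily_cons]
  rfl

/-- The recursion of `kkFamily` along a right descent. -/
theorem kkFamily_descent {w : W n} {i : Fin n}
    (h : act w (simpleRoot Φ i) ∉ positiveRoots Φ n) (u : W n) :
    linForm (act u (simpleRoot Φ i)) * kkFamily Φ w u =
      kkFamily Φ (w * simpleReflection i) u -
        kkFamily Φ (w * simpleReflection i) (u * simpleReflection i) := by
  have := kkFamily_mul_simple (act_mul_simple_mem h) u
  rwa [mul_simple_mul_simple] at this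

/-- Replacing `u` by `u s_i` changes the sign of both numerator and denominator of the divided
difference. -/
theorem kkFamily_apply_mul_simple {w : W n} {i : Fin n}
    (h : act w (simpleRoot Φ i) ∉ positiveRoots Φ n) (u : W n) :
    kkFamily Φ w (u * simpleReflection i) = kkFamily Φ w u := by
  have h1 := kkFamily_descent h u
  have h2 := kkFamily_descent h (u * simpleReflection i)
  rw [mul_simple_mul_simple, act_mul_simple_simpleRoot, linForm_neg] at h2
  apply mul_left_cancel₀ (linForm_ne_zero (act_simpleRoot_ne_zero (Φ := Φ) u i))
  linear_combination -h1 - h2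

/-! ### Positivity -/

/-- The point `(t, n - 1, …, 1)` as a function of `t`. -/
noncomputable def point (n : ℕ) (t : ℂ) (i : Fin n) : ℂ :=
  if i.val = 0 then t else (n : ℂ) - i

theorem eval_linForm (f : Fin n → ℂ) (v : Fin n → ℤ) :
    eval f (linForm v) = ∑ i, (v i : ℂ) * f i := by
  simp [linForm]

theorem eval_point_linForm (v : Fin n → ℤ) : eval (point n n) (linForm v) = rho v := by
  rw [eval_linForm, rho]
  push_cast
  refine Finset.sum_congr rfl fun i _ => ?_
  rw [point]
  split_ifs with h
  · simp [h]
  · rfl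

open scoped ComplexOrder

theorem eval_point_pos {v : Fin n → ℤ} (h : v ∈ positiveRoots Φ n) :
    0 < eval (point n n) (linForm v) := by
  rw [eval_point_linForm]
  exact_mod_cast rho_pos h

theorem eval_kkFamily_self_pos (w : W n) : 0 < eval (point n n) (kkFamily Φ w w) := by
  rw [kkFamily_self, map_prod]
  exact Finset.prod_pos fun v hv => eval_point_pos (mem_noninversions.mp hv).1

/-- Descending induction on `l(u)`. Choose `i` with `u s_i` longer. If `s_i` is a descent of `w`,
then `K_w(u) = K_w(u s_i)`; otherwise `K_w(u) = (u α_i) K_{w s_i}(u s_i) + K_w(u s_i)`, with `u α_i`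
positive. -/
theorem eval_kkFamily_nonneg (w u : W n) : 0 ≤ eval (point n n) (kkFamily Φ w u) := by
  induction hk : (positiveRoots Φ n).card - length u generalizing u w with
  | zero =>
    have hu := length_le_card Φ u
    have hw := length_le_card Φ w
    by_cases h : kkFamily Φ w u = 0
    · simp [h]
    · rcases kkFamily_support h with rfl | h1
      · exact (eval_kkFamily_self_pos _).le
      · omega
  | succ k ih =>
    obtain ⟨i, hi⟩ : ∃ i, act u (simpleRoot Φ i) ∈ positiveRoots Φ n := by
      by_contra! h
      rw [length_eq_card h] at hk
      omega
    have hl := length_mul_simple hi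
    by_cases hw : act w (simpleRoot Φ i) ∈ positiveRoots Φ n
    · have h1 := congrArg (eval (point n n)) (kkFamily_mul_simple hw u)
      rw [map_mul, map_sub, ← kkFamily_apply_mul_simple (act_mul_simple_notMem hw) u] at h1
      rw [← sub_add_cancel (eval (point n n) (kkFamily Φ w u))
        (eval (point n n) (kkFamily Φ w (u * simpleReflection i))), ← h1]
      exact add_nonneg (mul_nonneg (eval_point_pos hi).le (ih _ _ (by omega)))
        (ih _ _ (by omega))
    · rw [← kkFamily_apply_mul_simple hw]
      exact ih _ _ (by omega)

theorem eval_kkFamily_mul_simple_le (w : W n) {u : W n} {i : Fin n}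
    (h : act u (simpleRoot Φ i) ∈ positiveRoots Φ n) :
    eval (point n n) (kkFamily Φ w (u * simpleReflection i)) ≤
      eval (point n n) (kkFamily Φ w u) := by
  by_cases hw : act w (simpleRoot Φ i) ∈ positiveRoots Φ n
  · have h1 := congrArg (eval (point n n)) (kkFamily_mul_simple hw u)
    rw [map_mul, map_sub] at h1
    rw [← sub_nonneg, ← h1]
    exact mul_nonneg (eval_point_pos h).le (eval_kkFamily_nonneg _ _)
  · rw [kkFamily_apply_mul_simple hw]

/-- `kkFamily Φ p u` does not vanish if `u` is below `p` in the weak order. -/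
theorem eval_kkFamily_pos {p u : W n}
    (h : ∀ v ∈ positiveRoots Φ n, -act u v ∈ positiveRoots Φ n →
      -- This says that no positive root is inverted by both `u` and `p⁻¹ u`, that is, lengths add
      -- in `p = u (u⁻¹ p)`. Thus `u` climbs to `p` by right multiplications, along which the values
      -- decrease to the positive `K_p(p)`.
      act (p⁻¹ * u) v ∈ positiveRoots Φ n) :
    0 < eval (point n n) (kkFamily Φ p u) := by
  induction hk : (positiveRoots Φ n).card - length u using Nat.strong_induction_on
    generalizing u with
  | _ k ih =>
  by_cases h1 : p⁻¹ * u = 1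
  · rw [← inv_mul_eq_one.mp h1]
    exact eval_kkFamily_self_pos p
  · obtain ⟨i, hi⟩ := exists_descent Φ h1
    have hu : act u (simpleRoot Φ i) ∈ positiveRoots Φ n := by
      by_contra h2
      exact hi (h _ (simpleRoot_mem i) (neg_act_mem (simpleRoot_mem i) h2))
    refine lt_of_lt_of_le ?_ (eval_kkFamily_mul_simple_le p hu)
    have hl := length_mul_simple hu
    have hle := length_le_card Φ (u * simpleReflection i)
    refine ih _ (by omega) (fun v hv hv' => ?_) rfl
    rw [← mul_assoc]
    by_cases h3 : v = simpleRoot Φ i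
    · rw [h3]
      exact act_mul_simple_mem hi
    · rw [act_mul]
      rw [act_mul] at hv'
      exact h _ (act_simple_mem hv h3) hv'

/-! ### The rational functions `c_{w,v}` -/

theorem partialProd_cons (i : Fin n) (ω : List (Fin n)) (a : Fin 2) (e : Fin ω.length → Fin 2)
    (k : ℕ) : partialProd (i :: ω) (Fin.cons a e : Fin (ω.length + 1) → Fin 2) (k + 1) =
      simpleReflection i ^ a.val * partialProd ω e k := by
  simp [partialProd, List.ofFn_succ]

open Classical in
/-- The sum defining `c_{w,v}`, with all partial products multiplied by `u` from the left. -/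
noncomputable def translatedSum (Φ : BCType) (ω : List (Fin n)) (u : W n) : RatFun n :=
  ∑ e : Fin ω.length → Fin 2,
    if u * partialProd ω e ω.length = 1 then
      ∏ k : Fin ω.length,
        (algebraMap (PolyRing n) (RatFun n)
          (linForm (act (u * partialProd ω e (k.val + 1)) (simpleRoot Φ (ω.get k)))))⁻¹
    else 0

/-- Split by `e_1`. The choice `1` replaces `u` by `u s_i` and `u α_i` by its negative, which
produces the divided difference. The left factor `u` is there so that this recursion closes. -/
theorem translatedSum_cons (i : Fin n) (ω : List (Fin n)) (u : W n) :
    translatedSum Φ (i :: ω) u =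
      (algebraMap (PolyRing n) (RatFun n) (linForm (act u (simpleRoot Φ i))))⁻¹ *
        (translatedSum Φ ω u - translatedSum Φ ω (u * simpleReflection i)) := by
  have h : translatedSum Φ (i :: ω) u = ∑ a : Fin 2,
      (algebraMap (PolyRing n) (RatFun n)
        (linForm (act (u * simpleReflection i ^ a.val) (simpleRoot Φ i))))⁻¹ *
        translatedSum Φ ω (u * simpleReflection i ^ a.val) := by
    unfold translatedSum
    refine (Equiv.sum_comp (Fin.consEquiv fun _ : Fin (ω.length + 1) => Fin 2) _).symm.trans ?_
    rw [Fintype.sum_prod_type]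
    refine Finset.sum_congr rfl fun a _ => ?_
    rw [Finset.mul_sum]
    refine Finset.sum_congr rfl fun e _ => ?_
    change (if u * partialProd (i :: ω) (Fin.cons a e : Fin (ω.length + 1) → Fin 2)
        (ω.length + 1) = 1 then
      ∏ k : Fin (ω.length + 1), (algebraMap (PolyRing n) (RatFun n) (linForm (act
        (u * partialProd (i :: ω) (Fin.cons a e : Fin (ω.length + 1) → Fin 2) (k.val + 1))
        (simpleRoot Φ ((i :: ω).get k)))))⁻¹ else 0) = _
    rw [partialProd_cons, ← mul_assoc]
    by_cases hc : u * simpleReflection i ^ a.val * partialProd ω e ω.length = 1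
    swap
    · rw [if_neg hc, if_neg hc, mul_zero]
    rw [if_pos hc, if_pos hc]
    refine (Fin.prod_univ_succ _).trans (congrArg₂ (· * ·) ?_ ?_)
    · rw [Fin.val_zero, partialProd_cons]
      simp [partialProd]
    · refine Finset.prod_congr rfl fun k _ => ?_
      rw [Fin.val_succ, partialProd_cons, ← mul_assoc]
      rfl
  rw [h, Fin.sum_univ_two]
  simp only [Fin.val_zero, Fin.val_one, pow_zero, pow_one, mul_one]
  rw [act_mul_simple_simpleRoot, linForm_neg, map_neg]
  have h1 (x : RatFun n) : (-x)⁻¹ = -x⁻¹ := inv_neg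
  linear_combination translatedSum Φ ω (u * simpleReflection i) *
    h1 (algebraMap (PolyRing n) (RatFun n) (linForm (act u (simpleRoot Φ i))))

theorem translatedSum_mul_prod (ω : List (Fin n)) (u : W n) :
    translatedSum Φ ω u * ∏ α ∈ positiveRoots Φ n, algebraMap (PolyRing n) (RatFun n) (linForm α) =
      algebraMap (PolyRing n) (RatFun n) (wordFamily Φ ω u) := by
  induction ω generalizing u with
  | nil =>
    unfold translatedSum wordFamily
    rw [← map_prod]
    by_cases h : u = 1 <;> simp [h, partialProd]
  | cons i ω ih =>
    have hα : algebraMap (PolyRing n) (RatFun n) (linForm (act u (simpleRoot Φ i))) ≠ 0 := by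
      rw [ne_eq, FaithfulSMul.algebraMap_eq_zero_iff]
      exact linForm_ne_zero (act_simpleRoot_ne_zero u i)
    apply mul_left_cancel₀ hα
    rw [← map_mul, wordFamily_cons, map_sub, ← ih, ← ih, translatedSum_cons, ← mul_assoc,
      mul_inv_cancel_left₀ hα, sub_mul]

theorem cWord_one (ω : List (Fin n)) :
    cWord Φ ω 1 = (-1) ^ ω.length * translatedSum Φ ω 1 := by
  unfold cWord translatedSum
  simp only [one_mul]
  rw [Finset.sum_filter]

/-- The family uses a word of `w⁻¹` and `c_{w,id}` a word of `w`; involutivity identifies them. The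
two signs `(-1)^{l(w)}` cancel. -/
theorem algebraMap_kkFamily {w : W n} (hw : w * w = 1) :
    algebraMap (PolyRing n) (RatFun n) (kkFamily Φ w 1) = dRat Φ w := by
  have hinv : w⁻¹ = w := inv_eq_of_mul_eq_one_left hw
  obtain ⟨-, h2⟩ := reducedExpr_spec w
  rw [kkFamily, hinv, ← translatedSum_mul_prod, dRat, cRat, cWord_one, h2, ← mul_assoc, ← mul_pow]
  simp

/-! ### Elements fixing the letter `1` -/

theorem height_first {o : Fin n} (ho : o.val = 0) : height (Sum.inl o) = n := by simp [ho]

theorem height_lt_of_ne {o : Fin n} (ho : o.val = 0) {x : Letter n} (hx : x ≠ Sum.inl o) : height x < n := by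
  refine lt_of_le_of_ne (height_le x) fun h => hx ?_
  rw [← height_inj, h, height_first ho]

/-- If `p` fixes the greatest letter `1`, it keeps the first simple root positive. Hence its
descents are among the other `s_i`, which also fix `1`. -/
theorem levi_induction {o : Fin n} (ho : o.val = 0) (Φ : BCType) {P : W n → Prop} (one : P 1)
    (step : ∀ p i, p.1 (Sum.inl o) = Sum.inl o → (simpleReflection i).1 (Sum.inl o) = Sum.inl o →
      act p (simpleRoot Φ i) ∉ positiveRoots Φ n → P (p * simpleReflection i) → P p)
    (p : W n) (hp : p.1 (Sum.inl o) = Sum.inl o) : P p := by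
  induction hk : length p using Nat.strong_induction_on generalizing p with
  | _ k ih =>
  by_cases h1 : p = 1
  · rwa [h1]
  obtain ⟨i, hi⟩ := exists_descent Φ h1
  have hio : i ≠ o := by
    rintro rfl
    apply hi
    have hne : Sum.inl i ≠ next i := fun h => (height_next_lt i).ne (congrArg height h).symm
    rw [simpleRoot_eq, act_root, root_mem_positiveRoots fun h => hne (p.injective h), hp,
      height_first ho]
    apply height_lt_of_ne ho
    rw [← hp]
    exact fun h => hne (p.injective h).symm
  have hs : (simpleReflection i).1 (Sum.inl o) = Sum.inl o := by
    apply simple_apply_of_ne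
    · simpa using hio.symm
    · simp
    · unfold next
      split_ifs <;> simp [Fin.ext_iff, ho]
    · unfold next
      split_ifs
      · simp
      · simpa using hio.symm
  refine step p i hp hs hi (ih _ ?_ _ ?_ rfl)
  · rw [← hk]
    exact length_mul_simple_lt hi
  · rw [W.mul_apply, hs, hp]

theorem epsLetter_apply_of_ne {o : Fin n} {x : Letter n} (h1 : x ≠ Sum.inl o) (h2 : x ≠ Sum.inr o) :
    epsLetter x o = 0 := by
  rcases x with i | i
  · have : o ≠ i := by rintro rfl; exact h1 rfl
    simp [eps, this]
  · have : o ≠ i := by rintro rfl; exact h2 rfl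
    simp [eps, this]

theorem root_apply_of_ne {o : Fin n} {a b : Letter n} (h1 : a ≠ Sum.inl o) (h2 : a ≠ Sum.inr o)
    (h3 : b ≠ Sum.inl o) (h4 : b ≠ Sum.inr o) : root Φ a b o = 0 := by
  unfold root
  split_ifs
  · simp [epsLetter_apply_of_ne h1 h2]
  · simp [epsLetter_apply_of_ne h1 h2, epsLetter_apply_of_ne h3 h4]

theorem W.apply_ne {o : Fin n} {u : W n} (hu : u.1 (Sum.inl o) = Sum.inl o) {x : Letter n}
    (h1 : x ≠ Sum.inl o) (h2 : x ≠ Sum.inr o) : u.1 x ≠ Sum.inl o ∧ u.1 x ≠ Sum.inr o := by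
  have hu' : u.1 (Sum.inr o) = Sum.inr o := by
    have := u.apply_swap (Sum.inl o)
    rw [hu] at this
    exact this
  exact ⟨fun h => h1 (u.injective (h.trans hu.symm)), fun h => h2 (u.injective (h.trans hu'.symm))⟩

theorem act_simpleRoot_apply {o : Fin n} {u : W n} (hu : u.1 (Sum.inl o) = Sum.inl o) {i : Fin n}
    (hi : (simpleReflection i).1 (Sum.inl o) = Sum.inl o) : act u (simpleRoot Φ i) o = 0 := by
  have h1 : i ≠ o := by
    rintro rfl
    rw [simple_inl] at hi
    exact (height_next_lt i).ne (congrArg height hi)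
  have h2 : (Sum.inl i : Letter n) ≠ Sum.inl o := by simpa using h1
  have h3 := W.apply_ne hi h2 (by simp)
  rw [simple_inl] at h3
  have h4 := W.apply_ne hu h2 (by simp)
  have h5 := W.apply_ne hu h3.1 h3.2
  rw [simpleRoot_eq, act_root]
  exact root_apply_of_ne h4.1 h4.2 h5.1 h5.2

/-- Right multiplication by an `s_i` fixing `1` does not change whether `u` fixes `1`, so the
support never leaves this subgroup. -/
theorem kkFamily_levi_support {o : Fin n} (ho : o.val = 0) {p : W n} (hp : p.1 (Sum.inl o) = Sum.inl o) {u : W n}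
    (hu : u.1 (Sum.inl o) ≠ Sum.inl o) : kkFamily Φ p u = 0 := by
  revert u
  refine levi_induction ho Φ (P := fun p => ∀ {u : W n}, u.1 (Sum.inl o) ≠ Sum.inl o →
    kkFamily Φ p u = 0) ?_ ?_ p hp
  · intro u hu
    apply kkFamily_one_of_ne
    rintro rfl
    exact hu rfl
  · intro p i _ hs hi ih u hu
    have h := kkFamily_descent hi u
    rw [ih hu, ih (u := u * simpleReflection i) (by rwa [W.mul_apply, hs]), sub_zero] at h
    exact (mul_eq_zero.mp h).resolve_left (linForm_ne_zero (act_simpleRoot_ne_zero u i))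

theorem linForm_dvd_kkFamily {o : Fin n} (ho : o.val = 0) {p : W n} (hp : p.1 (Sum.inl o) = Sum.inl o) {v : Fin n → ℤ}
    (hv : v ∈ positiveRoots Φ n) (hvo : v o ≠ 0) (u : W n) : linForm v ∣ kkFamily Φ p u := by
  revert u
  refine levi_induction ho Φ (P := fun p => ∀ u, linForm v ∣ kkFamily Φ p u) ?_ ?_ p hp
  · intro u
    by_cases hu : u = 1
    · rw [hu, kkFamily_self, noninversions_one]
      exact Finset.dvd_prod_of_mem _ hv
    · rw [kkFamily_one_of_ne hu]
      exact dvd_zero _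
  · intro p i hp hs hi ih u
    by_cases hu : u.1 (Sum.inl o) = Sum.inl o
    · have hdvd : linForm v ∣ linForm (act u (simpleRoot Φ i)) * kkFamily Φ p u := by
        rw [kkFamily_descent hi]
        exact dvd_sub (ih _) (ih _)
      refine ((linForm_prime (ne_zero_of_mem hv)).dvd_or_dvd hdvd).resolve_left fun h => ?_
      -- The root divided by has no `ε_1`-coordinate whereas `v` has one, so they are not
      -- proportional.
      · obtain ⟨c, d, hc, h⟩ := proportional_of_linForm_dvd (ne_zero_of_mem hv) h
        have h1 := congrFun h o
        rw [Pi.smul_apply, act_simpleRoot_apply hu hs, smul_zero, Pi.smul_apply, smul_eq_mul,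
          zero_eq_mul] at h1
        rw [h1.resolve_right hvo, zero_smul, smul_eq_zero] at h
        exact act_simpleRoot_ne_zero u i (h.resolve_left hc)
    · rw [kkFamily_levi_support ho hp hu]
      exact dvd_zero _

/-! ### Moving a letter towards `1` -/

/-- The simple reflection `s_i` moves the letter `x` one step towards the letter `1`. -/
def MovesUp (i : Fin n) (x : Letter n) : Prop := x = next i ∨ x = Sum.inr i

theorem exists_movesUp {o : Fin n} (ho : o.val = 0) {x : Letter n} (hx : x ≠ Sum.inl o) :
    ∃ i, MovesUp i x := by
  rcases x with k | k
  · have hk : k.val ≠ 0 := by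
      intro h
      apply hx
      congr 1
      ext
      rw [h, ho]
    have hk' := k.2
    refine ⟨⟨k.val - 1, by omega⟩, Or.inl ?_⟩
    have h : (⟨k.val - 1, by omega⟩ : Fin n).val + 1 < n := by simp; omega
    rw [next, dif_pos h]
    congr 1
    ext
    simp
    omega
  · exact ⟨k, Or.inr rfl⟩

theorem simple_inr (i : Fin n) : (simpleReflection i).1 (Sum.inr i) = (next i).swap := by
  rw [← simple_inl, ← W.apply_swap]
  rfl

@[simp] theorem simple_simple (i : Fin n) (x : Letter n) :
    (simpleReflection i).1 ((simpleReflection i).1 x) = x := by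
  rw [← W.mul_apply, simpleReflection_mul_self, W.one_apply]

namespace MovesUp

variable {i : Fin n} {x : Letter n}

theorem height_lt (h : MovesUp i x) : height x < height ((simpleReflection i).1 x) := by
  have := height_next_lt i
  rcases h with rfl | rfl
  · rwa [simple_next]
  · rw [simple_inr, height_swap]
    simp only [height_inl, height_inr] at this ⊢
    omega

theorem simpleRoot_eq (h : MovesUp i x) :
    simpleRoot Φ i = root Φ ((simpleReflection i).1 x) x := by
  rw [KostantKumar.simpleRoot_eq]
  rcases h with rfl | rfl
  · rw [simple_next]
  · rw [simple_inr, ← root_swap_swap]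
    rfl

/-- The only pairs reversed by `s_i` have `s_i x` or `-x` as the greater letter, never `x`. -/
theorem order (h : MovesUp i x) {y : Letter n} (hy : height y < height x) :
    height ((simpleReflection i).1 y) < height ((simpleReflection i).1 x) := by
  by_contra h1
  have hne : next i ≠ Sum.inl i := fun h => (height_next_lt i).ne (congrArg height h)
  rcases simple_order i hy h1 with ⟨rfl, rfl⟩ | ⟨rfl, rfl⟩
  · rcases h with h | h
    · exact hne h.symm
    · simp at h
  · rcases h with h | h
    · exact swap_ne_self _ h
    · apply hne
      rw [← Sum.swap_swap (next i), h]
      rfl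

theorem fix (h : MovesUp i x) {y : Letter n} (h1 : y ≠ x) (h2 : y ≠ x.swap)
    (h3 : y ≠ (simpleReflection i).1 x) (h4 : y ≠ ((simpleReflection i).1 x).swap) :
    (simpleReflection i).1 y = y := by
  rcases h with rfl | rfl
  · rw [simple_next] at h3 h4
    exact simple_apply_of_ne h3 h4 h1 h2
  · rw [simple_inr] at h3 h4
    rw [Sum.swap_swap] at h4
    exact simple_apply_of_ne h2 h1 h4 h3

theorem order_of_ne (h : MovesUp i x) {a b : Letter n} (ha : a ≠ (simpleReflection i).1 x)
    (ha' : a ≠ ((simpleReflection i).1 x).swap) (hb : b ≠ (simpleReflection i).1 x)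
    (hb' : b ≠ ((simpleReflection i).1 x).swap) (hab : height b < height a) :
    height ((simpleReflection i).1 b) < height ((simpleReflection i).1 a) := by
  by_contra h1
  rcases simple_order i hab h1 with ⟨rfl, rfl⟩ | ⟨rfl, rfl⟩ <;> rcases h with rfl | rfl
  · exact ha (simple_next i).symm
  · rw [simple_inr, Sum.swap_swap] at hb'
    exact hb' rfl
  · rw [simple_next] at hb'
    exact hb' rfl
  · exact ha (simple_inr i).symm

/-- A letter moving up leaves the negative letters only through the step from `-n` to `n`. -/
theorem swap_or_neg (h : MovesUp i x) (hx : height x < 0) :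
    (simpleReflection i).1 x = x.swap ∨ height ((simpleReflection i).1 x) < 0 := by
  rcases h with rfl | rfl
  · left
    rw [simple_next]
    unfold next at hx ⊢
    split_ifs at hx ⊢ with h
    · simp at hx; omega
    · rfl
  · rw [simple_inr]
    unfold next
    split_ifs with h
    · right
      rw [height_swap, height_inl]
      push_cast
      omega
    · exact Or.inl rfl

/-- `w` sends the lower letter `x` of the pair `s_i x > x` to the greatest letter, so it inverts the
pair: `s_i` is a right descent of `w`. -/
theorem act_notMem (h : MovesUp i x) {o : Fin n} (ho : o.val = 0) {w : W n}
    (hw : w.1 x = Sum.inl o) : act w (simpleRoot Φ i) ∉ positiveRoots Φ n := by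
  have hne : (simpleReflection i).1 x ≠ x := fun h1 => h.height_lt.ne (congrArg height h1).symm
  rw [h.simpleRoot_eq, act_root, root_mem_positiveRoots fun h1 => hne (w.injective h1), hw,
    height_first ho, not_lt]
  exact height_le _

end MovesUp

/-- Induction along the path of the letter `w⁻¹ 1` to the letter `1`. -/
theorem path_induction {o : Fin n} (ho : o.val = 0) {P : W n → Letter n → Prop}
    (base : ∀ w : W n, w.1 (Sum.inl o) = Sum.inl o → P w (Sum.inl o))
    (step : ∀ (w : W n) (x : Letter n) (i : Fin n), w.1 x = Sum.inl o → MovesUp i x →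
      P (w * simpleReflection i) ((simpleReflection i).1 x) → P w x)
    (w : W n) (x : Letter n) (hx : w.1 x = Sum.inl o) : P w x := by
  induction hk : (n - height x).toNat using Nat.strong_induction_on generalizing w x with
  | _ k ih =>
  by_cases h : x = Sum.inl o
  · subst h
    exact base w hx
  · obtain ⟨i, hi⟩ := exists_movesUp ho h
    refine step w x i hx hi (ih _ ?_ _ _ ?_ rfl)
    · have := hi.height_lt
      have := height_le ((simpleReflection i).1 x)
      omega
    · rw [W.mul_apply, simple_simple, hx]

/-- Both terms of the recursion keep `u⁻¹ 1` below `w⁻¹ 1`, until `w` fixes `1` and `u` does not. -/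
theorem kkFamily_path_support {o : Fin n} (ho : o.val = 0) {w u : W n} {x y : Letter n}
    (hx : w.1 x = Sum.inl o) (hy : u.1 y = Sum.inl o) (h : height y < height x) :
    kkFamily Φ w u = 0 := by
  revert u y
  refine path_induction ho (P := fun w x => ∀ {u : W n} {y : Letter n}, u.1 y = Sum.inl o →
    height y < height x → kkFamily Φ w u = 0) ?_ ?_ w x hx
  · intro w hw u y hy h
    apply kkFamily_levi_support ho hw
    intro hu
    rw [← hu] at hy
    rw [u.injective hy] at h
    exact lt_irrefl _ h
  · intro w x i hx hi ih u y hy h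
    have h1 := kkFamily_descent (hi.act_notMem (Φ := Φ) ho hx) u
    rw [ih hy (h.trans hi.height_lt), ih (u := u * simpleReflection i)
      (y := (simpleReflection i).1 y) (by rw [W.mul_apply, simple_simple, hy]) (hi.order h),
      sub_zero] at h1
    exact (mul_eq_zero.mp h1).resolve_left (linForm_ne_zero (act_simpleRoot_ne_zero u i))

/-! ### Monotonicity away from a letter -/

/-- `u` preserves the order of the letters different from `±x`. -/
def MonotoneOff (u : W n) (x : Letter n) : Prop :=
  ∀ a b, a ≠ x → a ≠ x.swap → b ≠ x → b ≠ x.swap → height b < height a →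
    height (u.1 b) < height (u.1 a)

theorem monotoneOff_one (x : Letter n) : MonotoneOff 1 x := fun _ _ _ _ _ _ h => h

theorem MonotoneOff.swap {u : W n} {x : Letter n} (h : MonotoneOff u x) :
    MonotoneOff u x.swap := by
  intro a b h1 h2 h3 h4
  rw [Sum.swap_swap] at h2 h4
  exact h a b h2 h1 h4 h3

/-- A step of the path reverses only the pair `s_i x > x` and its negative, so the property travels
along with the moving letter. -/
theorem MonotoneOff.mul_simple {u : W n} {x : Letter n} (h : MonotoneOff u x) {i : Fin n}
    (hi : MovesUp i x) : MonotoneOff (u * simpleReflection i) ((simpleReflection i).1 x) := by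
  have hs (a : Letter n) (ha : a ≠ (simpleReflection i).1 x) : (simpleReflection i).1 a ≠ x := by
    rintro rfl
    simp at ha
  have hs' (a : Letter n) (ha : a ≠ ((simpleReflection i).1 x).swap) :
      (simpleReflection i).1 a ≠ x.swap := by
    intro h1
    apply ha
    rw [← W.apply_swap, ← h1, simple_simple]
  intro a b h1 h2 h3 h4 hab
  exact h _ _ (hs a h1) (hs' a h2) (hs b h3) (hs' b h4) (hi.order_of_ne h1 h2 h3 h4 hab)

/-- If `u` and `p` fix `1` and agree on the letter `x ∈ {1, 2}`, and `u` is increasing on the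
other letters, then `u` is below `p` in the weak order, so `kkFamily Φ p u` does not vanish. -/
theorem eval_kkFamily_pos_of_monotoneOff {o : Fin n} (ho : o.val = 0) {p u : W n} {x : Letter n}
    (hp : p.1 (Sum.inl o) = Sum.inl o) (hu : u.1 (Sum.inl o) = Sum.inl o)
    (hx : height x = n - 1 ∨ height x = n) (hpx : p.1 x = u.1 x) (h : MonotoneOff u x) :
    eval (point n n) (kkFamily Φ p u) ≠ 0 := by
  refine (eval_kkFamily_pos fun v hv hv' => ?_).ne'
  obtain ⟨a, b, hab, rfl⟩ := mem_positiveRoots.mp hv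
  have hne : a ≠ b := by rintro rfl; simp at hab
  rw [act_root, ← root_comm, root_mem_positiveRoots fun h1 => hne (u.injective h1).symm] at hv'
  rw [act_root, root_mem_positiveRoots fun h1 => hne ((p⁻¹ * u).injective h1)]
  have hq1 : (p⁻¹ * u).1 (Sum.inl o) = Sum.inl o := by
    rw [W.mul_apply, hu]
    nth_rewrite 1 [← hp]
    simp
  have hqx : (p⁻¹ * u).1 x = x := by
    rw [W.mul_apply, ← hpx]
    simp
  generalize p⁻¹ * u = q at hq1 hqx
  have hq1' : q.1 (Sum.inr o) = Sum.inr o := by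
    have := q.apply_swap (Sum.inl o)
    rw [hq1] at this
    exact this
  have hqx' : q.1 x.swap = x.swap := by rw [q.apply_swap, hqx]
  have key (y z : Letter n) (hz : q.1 z = z) (hyz : height y ≠ height z) :
      height (q.1 y) ≠ height z := by
    rw [ne_eq, height_inj] at hyz ⊢
    intro h1
    exact hyz (q.injective (h1.trans hz.symm))
  have hfix : height (Sum.inl o : Letter n) = n := height_first ho
  have hfix' : height (Sum.inr o : Letter n) = -n := by simp [ho]
  have hqa := height_le (q.1 a)
  have hqb := height_le (q.1 b)
  have hqa' := neg_le_height (q.1 a)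
  have hqb' := neg_le_height (q.1 b)
  have ha := height_le a
  have hb := height_le b
  have ha' := neg_le_height a
  have hb' := neg_le_height b
  have hsw : height x.swap = -height x := height_swap x
  -- By monotonicity an inverted pair of `u` must involve `±x`. Only the letter `1` can lie above
  -- `x`, and `q` fixes both, so `q` keeps the order of such pairs.
  by_cases h1 : a = x
  · subst h1
    have k1 := key b _ hqx (by omega)
    rw [hqx]
    have k2 := key b _ hq1
    omega
  by_cases h2 : a = x.swap
  · subst h2
    have hb1 : b = Sum.inr o := by rw [← height_inj]; omega
    subst hb1
    rw [hqx', hq1']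
    exact hab
  by_cases h3 : b = x
  · subst h3
    have ha1 : a = Sum.inl o := by rw [← height_inj]; omega
    subst ha1
    rw [hqx, hq1]
    exact hab
  by_cases h4 : b = x.swap
  · subst h4
    have k1 := key a _ hqx' (by omega)
    rw [hqx']
    have k2 := key a _ hq1'
    omega
  exact absurd (h a b h1 h2 h3 h4 hab) (by omega)

/-! ### Evaluation -/

/-- The evaluation at `(t, n - 1, …, 1)` with `t` an indeterminate. -/
noncomputable def lineEval (n : ℕ) : PolyRing n →ₐ[ℂ] Polynomial ℂ :=
  aeval fun i : Fin n => if i.val = 0 then Polynomial.X else Polynomial.C ((n : ℂ) - i)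

theorem eval_lineEval (t : ℂ) (p : PolyRing n) :
    (lineEval n p).eval t = eval (point n t) p := by
  induction p using MvPolynomial.induction_on with
  | C a => simp [lineEval]
  | add p q hp hq => simp [hp, hq]
  | mul_X p i hp =>
    rw [map_mul, Polynomial.eval_mul, hp, map_mul, eval_X, lineEval, aeval_X, point]
    split_ifs <;> simp

/-- A form without `ε_1` is constant along the line. -/
theorem lineEval_linForm {o : Fin n} {v : Fin n → ℤ} (ho : o.val = 0) (hv : v o = 0) :
    lineEval n (linForm v) = Polynomial.C (rho v : ℂ) := by
  rw [linForm, lineEval, map_sum, rho, Int.cast_sum, map_sum]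
  refine Finset.sum_congr rfl fun i _ => ?_
  rw [map_mul, aeval_X, aeval_C, Polynomial.algebraMap_eq]
  split_ifs with hi
  · have : i = o := by ext; rw [hi, ho]
    rw [this, hv]
    simp
  · push_cast
    simp

/-- The value of `ε_x` at the point `(t, n - 1, …, 1)`. -/
def level (o : Fin n) (t : ℤ) (x : Letter n) : ℤ :=
  if x = Sum.inl o then t else if x = Sum.inr o then -t else height x

theorem level_swap (o : Fin n) (t : ℤ) (x : Letter n) : level o t x.swap = -level o t x := by
  unfold level
  rcases x with i | i
  · by_cases h : i = o <;> simp [h]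
  · by_cases h : i = o <;> simp [h]

theorem level_of_ne {o : Fin n} {x : Letter n} (h1 : x ≠ Sum.inl o) (h2 : x ≠ Sum.inr o) (t : ℤ) :
    level o t x = height x := by
  rw [level, if_neg h1, if_neg h2]

theorem eval_epsLetter {o : Fin n} (ho : o.val = 0) (t : ℤ) (x : Letter n) :
    eval (point n t) (linForm (epsLetter x)) = level o t x := by
  have h (i : Fin n) : eval (point n t) (linForm (eps i)) = level o t (Sum.inl i) := by
    rw [eval_linForm, Finset.sum_eq_single i]
    · by_cases hi : i = o
      · simp [eps, point, level, hi, ho]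
      · have : i.val ≠ 0 := fun h => hi (by ext; rw [h, ho])
        simp [eps, point, level, hi, this]
    · intro j _ hj
      simp [eps, hj]
    · simp
  rcases x with i | i
  · exact h i
  · rw [epsLetter_inr, linForm_neg, map_neg, h, ← Int.cast_neg, ← level_swap]
    rfl

theorem eval_root_eq_zero {o : Fin n} (ho : o.val = 0) (t : ℤ) (a b : Letter n) :
    eval (point n t) (linForm (root Φ a b)) = 0 ↔ level o t a = level o t b := by
  unfold root
  split_ifs with h
  · rw [linForm_smul, map_mul, eval_C, eval_epsLetter ho, h, level_swap, mul_eq_zero]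
    have := Φ.mult_pos
    norm_cast
    omega
  · rw [linForm_sub, map_sub, eval_epsLetter ho, eval_epsLetter ho, sub_eq_zero]
    norm_cast

/-! ### The first column -/

/-- The positive roots involving `ε_1`. -/
def columnRoots (Φ : BCType) (o : Fin n) : Finset (Fin n → ℤ) :=
  (positiveRoots Φ n).filter fun v => v o ≠ 0

theorem exists_eq_root_of_mem_columnRoots {o : Fin n} (ho : o.val = 0) {v : Fin n → ℤ}
    (hv : v ∈ columnRoots Φ o) : ∃ b, b ≠ Sum.inl o ∧ v = root Φ (Sum.inl o) b := by
  obtain ⟨h1, h2⟩ := Finset.mem_filter.mp hv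
  obtain ⟨a, b, hab, rfl⟩ := mem_positiveRoots.mp h1
  by_cases ha : a = Sum.inl o
  · subst ha
    exact ⟨b, by rintro rfl; exact lt_irrefl _ hab, rfl⟩
  by_cases hb : b = Sum.inr o
  · subst hb
    refine ⟨a.swap, ?_, ?_⟩
    · intro h
      rw [← Sum.swap_swap a, h] at hab
      exact lt_irrefl _ hab
    · rw [← root_swap_swap]
      rfl
  refine absurd (root_apply_of_ne ha ?_ ?_ hb) h2
  · rintro rfl
    rw [height_inr, ho] at hab
    have := neg_le_height b
    simp at hab
    omega
  · rintro rfl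
    rw [height_first ho] at hab
    have := height_le a
    omega

theorem root_first_mem {o : Fin n} (ho : o.val = 0) {b : Letter n} (hb : b ≠ Sum.inl o) :
    root Φ (Sum.inl o) b ∈ columnRoots Φ o := by
  refine Finset.mem_filter.mpr ⟨mem_positiveRoots.mpr ⟨_, _, ?_, rfl⟩, ?_⟩
  · rw [height_first ho]
    exact height_lt_of_ne ho hb
  · unfold root
    split_ifs with h
    · simpa [eps] using Φ.mult_pos.ne'
    · have h1 : b ≠ Sum.inr o := h
      rw [Pi.sub_apply, epsLetter_apply_of_ne hb h1]
      simp [eps]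

/-- The hypothesis on `t` says that among the column roots only the one joining `1` and `z` can
vanish there, so the remaining product is nonzero. -/
theorem exists_lineEval_columnRoots {o : Fin n} (ho : o.val = 0) {t : ℤ} {z : Letter n}
    (hz : z ≠ Sum.inl o) (ht : ∀ b, b ≠ Sum.inl o → t = level o t b → b = z) :
    ∃ q : Polynomial ℂ, q.eval (t : ℂ) ≠ 0 ∧
      ∏ v ∈ columnRoots Φ o, lineEval n (linForm v) =
        lineEval n (linForm (root Φ (Sum.inl o) z)) * q := by
  classical
  refine ⟨∏ v ∈ (columnRoots Φ o).erase (root Φ (Sum.inl o) z), lineEval n (linForm v), ?_,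
    (Finset.mul_prod_erase _ _ (root_first_mem ho hz)).symm⟩
  rw [Polynomial.eval_prod, Finset.prod_ne_zero_iff]
  intro v hv
  obtain ⟨hne, hv⟩ := Finset.mem_erase.mp hv
  obtain ⟨b, hb, rfl⟩ := exists_eq_root_of_mem_columnRoots ho hv
  rw [eval_lineEval, ne_eq, eval_root_eq_zero ho]
  intro h
  apply hne
  rw [ht b hb (by rw [← h, level, if_pos rfl])]

/-- On elements fixing `1` one divides only by roots constant along the line, so the column product
survives up to a scalar. -/
theorem exists_lineEval_kkFamily {o : Fin n} (ho : o.val = 0) {p : W n}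
    (hp : p.1 (Sum.inl o) = Sum.inl o) (u : W n) :
    ∃ c : ℂ, lineEval n (kkFamily Φ p u) =
      Polynomial.C c * ∏ v ∈ columnRoots Φ o, lineEval n (linForm v) := by
  revert u
  refine levi_induction ho Φ (P := fun p => ∀ u, ∃ c : ℂ, lineEval n (kkFamily Φ p u) =
      Polynomial.C c * ∏ v ∈ columnRoots Φ o, lineEval n (linForm v)) ?_ ?_ p hp
  · intro u
    by_cases hu : u = 1
    · refine ⟨∏ v ∈ (positiveRoots Φ n).filter fun v => ¬ v o ≠ 0, (rho v : ℂ), ?_⟩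
      rw [hu, kkFamily_self, noninversions_one, map_prod, mul_comm, map_prod, columnRoots,
        ← Finset.prod_filter_mul_prod_filter_not (positiveRoots Φ n) fun v => v o ≠ 0]
      congr 1
      refine Finset.prod_congr rfl fun v hv => ?_
      exact lineEval_linForm ho (not_not.mp (Finset.mem_filter.mp hv).2)
    · exact ⟨0, by simp [kkFamily_one_of_ne hu]⟩
  · intro p i hp hs hi ih u
    by_cases hu : u.1 (Sum.inl o) = Sum.inl o
    · obtain ⟨c, hc⟩ := ih u
      obtain ⟨d, hd⟩ := ih (u * simpleReflection i)
      have h := congrArg (lineEval n) (kkFamily_descent hi u)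
      rw [map_mul, map_sub, hc, hd, lineEval_linForm ho (act_simpleRoot_apply hu hs)] at h
      have hr : (rho (act u (simpleRoot Φ i)) : ℂ) ≠ 0 := by
        norm_cast
        rcases act_mem_or (simpleRoot_mem (Φ := Φ) i) u with h | h
        · exact (rho_pos h).ne'
        · have := rho_pos h
          rw [rho_neg] at this
          omega
      refine ⟨(rho (act u (simpleRoot Φ i)) : ℂ)⁻¹ * (c - d), ?_⟩
      rw [Polynomial.C_mul, Polynomial.C_sub, mul_assoc, sub_mul, ← h, ← mul_assoc,
        ← Polynomial.C_mul, inv_mul_cancel₀ hr, Polynomial.C_1, one_mul]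
    · exact ⟨0, by simp [kkFamily_levi_support ho hp hu]⟩

theorem MovesUp.act_simpleRoot {i : Fin n} {x : Letter n} (h : MovesUp i x) (u : W n) :
    act u (simpleRoot Φ i) = root Φ (u.1 ((simpleReflection i).1 x)) (u.1 x) := by
  rw [h.simpleRoot_eq, act_root]

theorem mul_simple_apply_simple (i : Fin n) (u : W n) (x : Letter n) :
    (u * simpleReflection i).1 ((simpleReflection i).1 x) = u.1 x := by
  rw [W.mul_apply, simple_simple]

theorem eval_descent {w : W n} {i : Fin n} (h : act w (simpleRoot Φ i) ∉ positiveRoots Φ n)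
    (f : Fin n → ℂ) (u : W n) :
    eval f (linForm (act u (simpleRoot Φ i))) * eval f (kkFamily Φ w u) =
      eval f (kkFamily Φ (w * simpleReflection i) u) -
        eval f (kkFamily Φ (w * simpleReflection i) (u * simpleReflection i)) := by
  rw [← map_mul, kkFamily_descent h, map_sub]

theorem mul_inv_fix {o : Fin n} {w : W n} {x : Letter n} {i : Fin n} (hx : w.1 x = Sum.inl o)
    (hi : (simpleReflection i).1 x = Sum.inl o) :
    (w * simpleReflection i).1 (Sum.inl o) = Sum.inl o := by
  rw [W.mul_apply, ← hi, simple_simple, hx, hi]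

/-! ### The case `w 1 ≠ ± 1` -/

theorem level_height_eq {o : Fin n} {z b : Letter n} (hb : b ≠ Sum.inl o)
    (h : height z = level o (height z) b) : b = z := by
  by_cases hb' : b = Sum.inr o
  · subst hb'
    have := height_ne_zero z
    simp [level] at h
    omega
  · rw [level_of_ne hb hb', height_inj] at h
    exact h.symm

/-- The letter `x` is `2` if the reflection moves it to `1`. -/
theorem MovesUp.height_eq {o : Fin n} (ho : o.val = 0) {i : Fin n} {x : Letter n}
    (hi : MovesUp i x) (hx : x ≠ Sum.inr o) (hs : (simpleReflection i).1 x = Sum.inl o) :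
    height x = n - 1 := by
  rcases hi with rfl | rfl
  · rw [simple_next] at hs
    have : i = o := by simpa using hs
    subst this
    unfold next at hx ⊢
    split_ifs at hx ⊢ with h
    · simp [ho]
    · exact absurd rfl hx
  · rw [simple_inr] at hs
    exfalso
    have h1 : next i = Sum.inr o := by
      rw [← Sum.swap_swap (next i), hs]
      rfl
    unfold next at h1
    split_ifs at h1 with h
    exact hx h1

/-- The last step of the path. The second term vanishes because `u s_i` no longer fixes `1`; the
first is a scalar times the column product, divided by the root joining `1` and `u x`. The factor
vanishing at the point is cancelled only if `u x = z`. -/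
theorem eval_kkFamily_step_two {o : Fin n} (ho : o.val = 0) {z : Letter n} (hz : z ≠ Sum.inl o)
    (hz' : z ≠ Sum.inr o) {w : W n} {x : Letter n} {i : Fin n} (hx : w.1 x = Sum.inl o)
    (hi : MovesUp i x) (hs : (simpleReflection i).1 x = Sum.inl o) {u : W n}
    (hu : u.1 (Sum.inl o) = Sum.inl o) (hux' : u.1 x ≠ Sum.inr o) :
    (u.1 x ≠ z → eval (point n (height z : ℤ)) (kkFamily Φ w u) = 0) ∧
      (u.1 x = z → eval (point n n) (kkFamily Φ (w * simpleReflection i) u) ≠ 0 →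
        eval (point n (height z : ℤ)) (kkFamily Φ w u) ≠ 0) := by
  have hp := mul_inv_fix hx hs
  have hxo : x ≠ Sum.inl o := by
    rintro rfl
    have := hi.height_lt
    rw [hs] at this
    exact lt_irrefl _ this
  have hux : u.1 x ≠ Sum.inl o := fun h => hxo (u.injective (h.trans hu.symm))
  have h0 : kkFamily Φ (w * simpleReflection i) (u * simpleReflection i) = 0 := by
    apply kkFamily_levi_support ho hp
    rw [← hs, mul_simple_apply_simple, hs]
    exact hux
  have h1 := kkFamily_descent (hi.act_notMem (Φ := Φ) ho hx) u
  rw [h0, sub_zero, hi.act_simpleRoot, hs, hu] at h1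
  obtain ⟨c, hc⟩ := exists_lineEval_kkFamily (Φ := Φ) ho hp u
  obtain ⟨q, hq, hq'⟩ := exists_lineEval_columnRoots (Φ := Φ) ho hz
    fun b hb h => level_height_eq hb h
  have h2 := congrArg (lineEval n) h1
  rw [map_mul, hc, hq'] at h2
  constructor
  · intro hne
    have h3 := congrArg (Polynomial.eval ((height z : ℤ) : ℂ)) h2
    have h4 : eval (point n (height z : ℤ)) (linForm (root Φ (Sum.inl o) z)) = 0 := by
      rw [eval_root_eq_zero ho, level_of_ne hz hz', level, if_pos rfl]
    simp only [Polynomial.eval_mul, eval_lineEval, h4, zero_mul, mul_zero] at h3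
    refine (mul_eq_zero.mp h3).resolve_left fun h5 => hne ?_
    rw [eval_root_eq_zero ho, level, if_pos rfl] at h5
    exact level_height_eq hux h5
  · rintro rfl hne
    have hc0 : c ≠ 0 := by
      rintro rfl
      apply hne
      rw [← eval_lineEval, hc]
      simp
    have hr : lineEval n (linForm (root Φ (Sum.inl o) (u.1 x))) ≠ 0 := by
      intro h
      have h3 := congrArg (Polynomial.eval (n : ℂ)) h
      rw [eval_lineEval, Polynomial.eval_zero] at h3
      have h4 := (eval_root_eq_zero (Φ := Φ) ho n (Sum.inl o) (u.1 x)).mp (by exact_mod_cast h3)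
      rw [level_of_ne hz hz', level, if_pos rfl] at h4
      have := height_lt_of_ne ho hz
      omega
    rw [mul_left_comm] at h2
    rw [← eval_lineEval, mul_left_cancel₀ hr h2, Polynomial.eval_mul, Polynomial.eval_C]
    exact mul_ne_zero hc0 hq

/-- As long as `u⁻¹ z` stays below the moving letter, both terms of the recursion inherit the
vanishing and the divisor is nonzero at the point. At the last step `u x ≠ z`, so the vanishing
column root is not cancelled. -/
theorem eval_kkFamily_eq_zero_of_lt {o : Fin n} (ho : o.val = 0) {z : Letter n}
    (hz : z ≠ Sum.inl o) (hz' : z ≠ Sum.inr o) (w : W n) (x : Letter n) (hx : w.1 x = Sum.inl o) :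
    x ≠ Sum.inl o → x ≠ Sum.inr o → ∀ (u : W n) (y : Letter n), u.1 (Sum.inl o) = Sum.inl o →
      u.1 y = z → height y < height x → eval (point n (height z : ℤ)) (kkFamily Φ w u) = 0 := by
  refine path_induction ho (P := fun w x => x ≠ Sum.inl o → x ≠ Sum.inr o →
    ∀ (u : W n) (y : Letter n), u.1 (Sum.inl o) = Sum.inl o →
      u.1 y = z → height y < height x → eval (point n (height z : ℤ)) (kkFamily Φ w u) = 0)
    ?_ ?_ w x hx
  · intro w _ h
    exact absurd rfl h
  · intro w x i hx hi ih h1 h2 u y hu hy hyx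
    have hux := W.apply_ne hu h1 h2
    by_cases hs : (simpleReflection i).1 x = Sum.inl o
    · refine (eval_kkFamily_step_two ho hz hz' hx hi hs hu hux.2).1 ?_
      rintro rfl
      rw [u.injective hy] at hyx
      exact lt_irrefl _ hyx
    · have hs' : (simpleReflection i).1 x ≠ Sum.inr o := by
        intro h
        have h3 := hi.height_lt
        rw [h] at h3
        have := neg_le_height x
        simp [ho] at h3
        omega
      have ih := ih hs hs'
      have hfix : (simpleReflection i).1 (Sum.inl o) = Sum.inl o := by
        refine hi.fix h1.symm ?_ (Ne.symm hs) ?_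
        · intro h
          apply h2
          rw [← Sum.swap_swap x, ← h]
          rfl
        · intro h
          apply hs'
          rw [← Sum.swap_swap ((simpleReflection i).1 x), ← h]
          rfl
      have h3 := eval_descent (hi.act_notMem (Φ := Φ) ho hx) (point n (height z : ℤ)) u
      rw [ih u y hu hy (hyx.trans hi.height_lt),
        ih (u * simpleReflection i) ((simpleReflection i).1 y)
          (by rw [W.mul_apply, hfix, hu]) (by rw [mul_simple_apply_simple, hy]) (hi.order hyx),
        sub_zero] at h3
      -- The divisor joins two letters other than `±1`, whose values at the point are their distinct
      -- heights.
      refine (mul_eq_zero.mp h3).resolve_left fun h4 => ?_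
      rw [hi.act_simpleRoot, eval_root_eq_zero ho, level_of_ne hux.1 hux.2] at h4
      have hus := W.apply_ne hu hs hs'
      rw [level_of_ne hus.1 hus.2, height_inj] at h4
      exact hi.height_lt.ne (congrArg height (u.injective h4)).symm

/-- Follow `u ↦ u s_i` along the path, so that the moving letter keeps going to `z`. The discarded
term vanishes at the point by `eval_kkFamily_eq_zero_of_lt`, and the last step cancels the vanishing
root. -/
theorem eval_kkFamily_ne_zero {o : Fin n} (ho : o.val = 0) {z : Letter n}
    (hz : z ≠ Sum.inl o) (hz' : z ≠ Sum.inr o) (w : W n) (x : Letter n) (hx : w.1 x = Sum.inl o) :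
    x ≠ Sum.inl o → x ≠ Sum.inr o → w.1 (Sum.inl o) = z →
      ∀ u : W n, u.1 (Sum.inl o) = Sum.inl o → u.1 x = z → MonotoneOff u x →
        eval (point n (height z : ℤ)) (kkFamily Φ w u) ≠ 0 := by
  refine path_induction ho (P := fun w x => x ≠ Sum.inl o → x ≠ Sum.inr o →
    w.1 (Sum.inl o) = z → ∀ u : W n, u.1 (Sum.inl o) = Sum.inl o → u.1 x = z → MonotoneOff u x →
        eval (point n (height z : ℤ)) (kkFamily Φ w u) ≠ 0) ?_ ?_ w x hx
  · intro w _ h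
    exact absurd rfl h
  · intro w x i hx hi ih h1 h2 hw u hu hux hmono
    by_cases hs : (simpleReflection i).1 x = Sum.inl o
    · refine (eval_kkFamily_step_two ho hz hz' hx hi hs hu (by rwa [hux])).2 hux ?_
      refine eval_kkFamily_pos_of_monotoneOff ho (mul_inv_fix hx hs) hu
        (Or.inl (hi.height_eq ho h2 hs)) ?_ hmono
      rw [W.mul_apply, hs, hw, hux]
    · have hs' : (simpleReflection i).1 x ≠ Sum.inr o := by
        intro h
        have h3 := hi.height_lt
        rw [h] at h3
        have := neg_le_height x
        simp [ho] at h3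
        omega
      have hfix : (simpleReflection i).1 (Sum.inl o) = Sum.inl o := by
        refine hi.fix h1.symm ?_ (Ne.symm hs) ?_
        · intro h
          apply h2
          rw [← Sum.swap_swap x, ← h]
          rfl
        · intro h
          apply hs'
          rw [← Sum.swap_swap ((simpleReflection i).1 x), ← h]
          rfl
      have h3 := eval_descent (hi.act_notMem (Φ := Φ) ho hx) (point n (height z : ℤ)) u
      rw [eval_kkFamily_eq_zero_of_lt ho hz hz' (w * simpleReflection i)
        ((simpleReflection i).1 x) (by rw [mul_simple_apply_simple, hx]) hs hs' u x hu hux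
        hi.height_lt, zero_sub] at h3
      have h4 := ih hs hs' (by rw [W.mul_apply, hfix, hw]) (u * simpleReflection i)
        (by rw [W.mul_apply, hfix, hu]) (by rw [mul_simple_apply_simple, hux])
        (hmono.mul_simple hi)
      intro h5
      rw [h5, mul_zero, zero_eq_neg] at h3
      exact h4 h3

/-! ### The case `w 1 = -1` -/

/-- At `t = 0` only the opposite letters `1` and `-1` take the same value. -/
theorem level_zero_ne {o : Fin n} {a b : Letter n} (h1 : a ≠ b) (h2 : a ≠ b.swap) :
    level o 0 a ≠ level o 0 b := by
  have ha := height_ne_zero a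
  have hb := height_ne_zero b
  rw [ne_eq, ← height_inj] at h1
  unfold level
  split_ifs with h3 h4 h5 h6 h7 <;> first | omega | (subst_vars; simp at *)

theorem eval_zero_act_simpleRoot_ne_zero {o : Fin n} (ho : o.val = 0) {i : Fin n} {x : Letter n}
    (hi : MovesUp i x) (hs : (simpleReflection i).1 x ≠ x.swap) (u : W n) :
    eval (point n (0 : ℤ)) (linForm (act u (simpleRoot Φ i))) ≠ 0 := by
  rw [hi.act_simpleRoot, ne_eq, eval_root_eq_zero ho]
  apply level_zero_ne
  · intro h
    exact hi.height_lt.ne (congrArg height (u.injective h)).symm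
  · rw [← u.apply_swap]
    exact fun h => hs (u.injective h)

theorem MovesUp.ne_swap {i : Fin n} {x : Letter n} (hi : MovesUp i x) (hx : 0 < height x) :
    (simpleReflection i).1 x ≠ x.swap := by
  intro h
  have := hi.height_lt
  rw [h, height_swap] at this
  omega

theorem eq_inr_of_level_zero {o : Fin n} {b : Letter n} (hb : b ≠ Sum.inl o)
    (h : 0 = level o 0 b) : b = Sum.inr o := by
  by_contra hb'
  rw [level_of_ne hb hb'] at h
  exact height_ne_zero b h.symm

theorem lineEval_root_first {o : Fin n} (ho : o.val = 0) :
    lineEval n (linForm (root Φ (Sum.inl o) (Sum.inr o))) =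
      Polynomial.C (Φ.mult : ℂ) * Polynomial.X := by
  have h : lineEval n (linForm (eps o)) = Polynomial.X := by
    rw [linForm, map_sum, Finset.sum_eq_single o]
    · simp [lineEval, eps, ho]
    · intro j _ hj
      simp [eps, hj]
    · simp
  have hr : root Φ (Sum.inl o) (Sum.inr o) = Φ.mult • eps o := by simp [root]
  rw [hr, linForm_smul, map_mul, h]
  simp [lineEval]

/-- The column product contains a multiple of `ε_1`, and on the positive part of the path no divisor
vanishes at `t = 0`. -/
theorem eval_zero_kkFamily_eq_zero_of_pos {o : Fin n} (ho : o.val = 0) (w : W n) (x : Letter n)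
    (hx : w.1 x = Sum.inl o) :
    0 < height x → ∀ u, eval (point n (0 : ℤ)) (kkFamily Φ w u) = 0 := by
  refine path_induction ho (P := fun w x =>
    0 < height x → ∀ u, eval (point n (0 : ℤ)) (kkFamily Φ w u) = 0) ?_ ?_ w x hx
  · intro w hw _ u
    obtain ⟨c, hc⟩ := exists_lineEval_kkFamily (Φ := Φ) ho hw u
    obtain ⟨q, -, hq⟩ := exists_lineEval_columnRoots (Φ := Φ) ho (z := Sum.inr o) (by simp)
      fun b hb h => eq_inr_of_level_zero hb h
    rw [← eval_lineEval, hc, hq, lineEval_root_first ho]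
    simp
  · intro w x i hx hi ih hpos u
    have ih := ih (hpos.trans hi.height_lt)
    have h := eval_descent (hi.act_notMem (Φ := Φ) ho hx) (point n (0 : ℤ)) u
    rw [ih, ih, sub_zero] at h
    exact (mul_eq_zero.mp h).resolve_left
      (eval_zero_act_simpleRoot_ne_zero ho hi (hi.ne_swap hpos) u)

/-- Only the crossing from `-n` to `n` can cancel `ε_1`, and only when `u x = ±1` there; the bound
on `y = u⁻¹ 1` prevents this. -/
theorem eval_zero_kkFamily_eq_zero_of_neg {o : Fin n} (ho : o.val = 0) (w : W n) (x : Letter n)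
    (hx : w.1 x = Sum.inl o) : height x < 0 → ∀ (u : W n) (y : Letter n), u.1 y = Sum.inl o →
      -height x < height y → eval (point n (0 : ℤ)) (kkFamily Φ w u) = 0 := by
  refine path_induction ho (P := fun w x => height x < 0 → ∀ (u : W n) (y : Letter n),
    u.1 y = Sum.inl o → -height x < height y →
      eval (point n (0 : ℤ)) (kkFamily Φ w u) = 0) ?_ ?_ w x hx
  · intro w hw h
    have := height_first ho
    omega
  · intro w x i hx hi ih hneg u y hy hyx
    have h := eval_descent (hi.act_notMem (Φ := Φ) ho hx) (point n (0 : ℤ)) u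
    have hx' : (w * simpleReflection i).1 ((simpleReflection i).1 x) = Sum.inl o := by
      rw [mul_simple_apply_simple, hx]
    by_cases hs : (simpleReflection i).1 x = x.swap
    · have h0 := eval_zero_kkFamily_eq_zero_of_pos (Φ := Φ) ho _ _ hx'
        (by rw [hs, height_swap]; omega)
      rw [h0, h0, sub_zero] at h
      refine (mul_eq_zero.mp h).resolve_left fun h1 => ?_
      rw [hi.act_simpleRoot, hs, eval_root_eq_zero ho, u.apply_swap, level_swap] at h1
      have h2 : level o 0 (u.1 x) = 0 := by omega
      have h3 : u.1 x ≠ Sum.inl o := by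
        intro h3
        rw [← hy] at h3
        rw [u.injective h3] at hyx hneg
        omega
      have h4 := eq_inr_of_level_zero h3 h2.symm
      have h5 : u.1 x.swap = Sum.inl o := by
        rw [u.apply_swap, h4]
        rfl
      rw [← hy] at h5
      rw [← u.injective h5, height_swap] at hyx
      omega
    · have hneg' := (hi.swap_or_neg hneg).resolve_left hs
      have h1 := hi.order (y := y.swap) (by rw [height_swap]; omega)
      rw [W.apply_swap, height_swap] at h1
      have h2 := hi.height_lt
      rw [ih hneg' u y hy (by omega), ih hneg' (u * simpleReflection i) ((simpleReflection i).1 y)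
        (by rw [mul_simple_apply_simple, hy]) (by omega), sub_zero] at h
      exact (mul_eq_zero.mp h).resolve_left (eval_zero_act_simpleRoot_ne_zero ho hi hs u)

/-- On the positive part of the path the restriction has a simple zero at `t = 0`. At the end of the
path exactly one column factor vanishes; every step has one term identically zero by
`kkFamily_path_support` and a divisor nonzero at `t = 0`. -/
theorem exists_lineEval_kkFamily_of_pos {o : Fin n} (ho : o.val = 0) (w : W n) (x : Letter n)
    (hx : w.1 x = Sum.inl o) : 0 < height x → ∀ u : W n, u.1 x = Sum.inl o → MonotoneOff u x →
      ∃ q : Polynomial ℂ, lineEval n (kkFamily Φ w u) = Polynomial.X * q ∧ q.eval 0 ≠ 0 := by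
  refine path_induction ho (P := fun w x => 0 < height x → ∀ u : W n, u.1 x = Sum.inl o →
    MonotoneOff u x → ∃ q : Polynomial ℂ,
      lineEval n (kkFamily Φ w u) = Polynomial.X * q ∧ q.eval 0 ≠ 0) ?_ ?_ w x hx
  · intro w hw _ u hu hmono
    obtain ⟨c, hc⟩ := exists_lineEval_kkFamily (Φ := Φ) ho hw u
    obtain ⟨q, hq', hq⟩ := exists_lineEval_columnRoots (Φ := Φ) ho (z := Sum.inr o) (by simp)
      fun b hb h => eq_inr_of_level_zero hb h
    have hne := eval_kkFamily_pos_of_monotoneOff (Φ := Φ) ho hw hu (Or.inr (height_first ho))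
      (by rw [hw, hu]) hmono
    have hc0 : c ≠ 0 := by
      rintro rfl
      apply hne
      rw [← eval_lineEval, hc]
      simp
    refine ⟨Polynomial.C c * (Polynomial.C (Φ.mult : ℂ) * q), ?_, ?_⟩
    · rw [hc, hq, lineEval_root_first ho]
      ring
    · have : (Φ.mult : ℂ) ≠ 0 := by exact_mod_cast Φ.mult_pos.ne'
      rw [Int.cast_zero] at hq'
      simp [hc0, hq', this]
  · intro w x i hx hi ih hpos u hu hmono
    have hx' : (w * simpleReflection i).1 ((simpleReflection i).1 x) = Sum.inl o := by
      rw [mul_simple_apply_simple, hx]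
    obtain ⟨q, hq, hq'⟩ := ih (hpos.trans hi.height_lt) (u * simpleReflection i)
      (by rw [mul_simple_apply_simple, hu]) (hmono.mul_simple hi)
    have h := congrArg (lineEval n) (kkFamily_descent (hi.act_notMem (Φ := Φ) ho hx) u)
    rw [map_mul, map_sub, kkFamily_path_support ho hx' hu hi.height_lt, map_zero, zero_sub, hq] at h
    have h0 := eval_zero_act_simpleRoot_ne_zero (Φ := Φ) ho hi (hi.ne_swap hpos) u
    rw [← eval_lineEval, Int.cast_zero] at h0
    have hdvd : (Polynomial.X : Polynomial ℂ) ∣ lineEval n (kkFamily Φ w u) := by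
      refine (Polynomial.prime_X.dvd_or_dvd (Dvd.intro (-q) (by rw [h]; ring))).resolve_left ?_
      rwa [Polynomial.X_dvd_iff, Polynomial.coeff_zero_eq_eval_zero]
    obtain ⟨r, hr⟩ := hdvd
    refine ⟨r, hr, fun hr0 => hq' ?_⟩
    rw [hr, mul_left_comm, ← mul_neg] at h
    have h1 := congrArg (Polynomial.eval 0) (mul_left_cancel₀ Polynomial.X_ne_zero h)
    simpa [hr0] using h1

/-- On the negative part one term vanishes at `t = 0` and the other carries on. At the crossing the
divisor is a multiple of `ε_1` and cancels the simple zero from the positive part. -/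
theorem eval_zero_kkFamily_ne_zero {o : Fin n} (ho : o.val = 0) (w : W n) (x : Letter n)
    (hx : w.1 x = Sum.inl o) : height x < 0 → ∀ u : W n, u.1 x.swap = Sum.inl o →
      MonotoneOff u x → eval (point n (0 : ℤ)) (kkFamily Φ w u) ≠ 0 := by
  refine path_induction ho (P := fun w x => height x < 0 → ∀ u : W n, u.1 x.swap = Sum.inl o →
    MonotoneOff u x → eval (point n (0 : ℤ)) (kkFamily Φ w u) ≠ 0) ?_ ?_ w x hx
  · intro w hw h
    have := height_first ho
    omega
  · intro w x i hx hi ih hneg u hu hmono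
    have hx' : (w * simpleReflection i).1 ((simpleReflection i).1 x) = Sum.inl o := by
      rw [mul_simple_apply_simple, hx]
    have hlt := hi.height_lt
    by_cases hs : (simpleReflection i).1 x = x.swap
    · have hsx : (simpleReflection i).1 x.swap = x := by rw [← hs, simple_simple]
      have h := congrArg (lineEval n) (kkFamily_descent (hi.act_notMem (Φ := Φ) ho hx) u)
      rw [hs] at hx'
      obtain ⟨q, hq, hq'⟩ := exists_lineEval_kkFamily_of_pos (Φ := Φ) ho _ _ hx'
        (by rw [height_swap]; omega) u hu hmono.swap
      -- After the crossing `w s_i` sends `-x` to `1`, while `u s_i` sends the lower letter `x` to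
      -- `1`.
      have h0 : kkFamily Φ (w * simpleReflection i) (u * simpleReflection i) = 0 := by
        refine kkFamily_path_support ho hx' (y := x) ?_ (by rw [height_swap]; omega)
        rw [W.mul_apply, hs, hu]
      have hux : u.1 x = Sum.inr o := by
        rw [← Sum.swap_swap x, u.apply_swap, hu]
        rfl
      rw [map_mul, map_sub, h0, map_zero, sub_zero, hq, hi.act_simpleRoot, hs, hu, hux,
        lineEval_root_first ho, mul_assoc, mul_left_comm] at h
      have h1 := congrArg (Polynomial.eval 0) (mul_left_cancel₀ Polynomial.X_ne_zero h)
      rw [Polynomial.eval_mul, ← Int.cast_zero (R := ℂ), eval_lineEval] at h1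
      intro h2
      rw [h2, mul_zero, Int.cast_zero] at h1
      exact hq' h1.symm
    · have hneg' := (hi.swap_or_neg hneg).resolve_left hs
      have h := eval_descent (hi.act_notMem (Φ := Φ) ho hx) (point n (0 : ℤ)) u
      rw [eval_zero_kkFamily_eq_zero_of_neg ho _ _ hx' hneg' u x.swap hu
        (by rw [height_swap]; omega), zero_sub] at h
      intro h1
      rw [h1, mul_zero, zero_eq_neg] at h
      refine ih hneg' (u * simpleReflection i) ?_ (hmono.mul_simple hi) h
      rw [← W.apply_swap, mul_simple_apply_simple, hu]

/-! ### Divisibility by the roots of the first column -/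

/-- Divisibility would force `K_w(1)` to vanish wherever the root does. Involutivity gives `w z =
1`, so the path starts at `x = z` with `u` the identity. -/
theorem not_linForm_dvd_kkFamily_one {o : Fin n} (ho : o.val = 0) {w : W n} (hw : w * w = 1)
    {z : Letter n} (hz : w.1 (Sum.inl o) = z) (hzo : z ≠ Sum.inl o) :
    ¬ linForm (root Φ (Sum.inl o) z) ∣ kkFamily Φ w 1 := by
  have hwz : w.1 z = Sum.inl o := by
    rw [← hz, ← W.mul_apply, hw, W.one_apply]
  intro hdvd
  by_cases hz' : z = Sum.inr o
  · subst hz'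
    have h := map_dvd (eval (point n (0 : ℤ))) hdvd
    rw [(eval_root_eq_zero ho 0 _ _).mpr (by simp [level]), zero_dvd_iff] at h
    refine eval_zero_kkFamily_ne_zero (Φ := Φ) ho w (Sum.inr o) hwz ?_ 1 rfl (monotoneOff_one _) h
    have := o.2
    simp [ho]
    omega
  · have h := map_dvd (eval (point n (height z : ℤ))) hdvd
    rw [(eval_root_eq_zero ho _ _ _).mpr (by rw [level_of_ne hzo hz', level, if_pos rfl]),
      zero_dvd_iff] at h
    exact eval_kkFamily_ne_zero (Φ := Φ) ho hzo hz' w z hwz hzo hz' hz 1 rfl rfl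
      (monotoneOff_one _) h

/-! ### The first column and the support in terms of letters. -/

theorem mem_firstColumn_iff {o : Fin n} (ho : o.val = 0) {α : Fin n → ℤ} :
    α ∈ firstColumn Φ n ↔ ∃ z, z ≠ Sum.inl o ∧ α = root Φ (Sum.inl o) z := by
  have huniq (i : Fin n) (hi : i.val = 0) : i = o := by ext; rw [hi, ho]
  constructor
  · rintro ⟨i, hi, h⟩
    rw [huniq i hi] at h
    rcases h with ⟨j, hj, rfl⟩ | ⟨j, hj, rfl⟩ | rfl
    · exact ⟨Sum.inl j, by simpa using hj.ne', by simp [root]⟩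
    · exact ⟨Sum.inr j, by simp, by simp [root, hj.ne']⟩
    · exact ⟨Sum.inr o, by simp, by simp [root]⟩
  · rintro ⟨j | j, hj, rfl⟩
    · have hjo : j ≠ o := by rintro rfl; exact hj rfl
      have hlt : o < j := by
        rw [Fin.lt_def, ho, Nat.pos_iff_ne_zero]
        exact fun h => hjo (huniq j h)
      exact ⟨o, ho, Or.inl ⟨j, hlt, by simp [root]⟩⟩
    · by_cases hjo : j = o
      · subst hjo
        exact ⟨j, ho, Or.inr (Or.inr (by simp [root]))⟩
      · have hlt : o < j := by
          rw [Fin.lt_def, ho, Nat.pos_iff_ne_zero]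
          exact fun h => hjo (huniq j h)
        exact ⟨o, ho, Or.inr (Or.inl ⟨j, hlt, by simp [root, hjo]⟩)⟩

theorem root_mem_supp {o : Fin n} (ho : o.val = 0) {w : W n}
    (h : w.1 (Sum.inl o) ≠ Sum.inl o) :
    root Φ (Sum.inl o) (w.1 (Sum.inl o)) ∈ supp Φ w := by
  have hlt (j : Fin n) (hj : j ≠ o) : o < j := by
    rw [Fin.lt_def, ho, Nat.pos_iff_ne_zero]
    exact fun h => hj (by ext; rw [h, ho])
  rcases hw : w.1 (Sum.inl o) with j | j
  · rw [hw] at h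
    have hj : j ≠ o := by rintro rfl; exact h rfl
    exact Or.inl ⟨o, j, hlt j hj, hw, by simp [root]⟩
  · by_cases hj : j = o
    · subst hj
      exact Or.inr (Or.inr ⟨j, hw, by simp [root]⟩)
    · exact Or.inr (Or.inl ⟨o, j, hlt j hj, hw, by simp [root, hj]⟩)

theorem eq_root_of_mem_supp {o : Fin n} (ho : o.val = 0) {w : W n} {β : Fin n → ℤ}
    (h : β ∈ supp Φ w) (hβ : β o ≠ 0) :
    w.1 (Sum.inl o) ≠ Sum.inl o ∧ β = root Φ (Sum.inl o) (w.1 (Sum.inl o)) := by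
  have hgt (i j : Fin n) (hij : i < j) : o ≠ j := by
    rintro rfl
    rw [Fin.lt_def, ho] at hij
    omega
  rcases h with ⟨i, j, hij, hw, rfl⟩ | ⟨i, j, hij, hw, rfl⟩ | ⟨i, hw, rfl⟩
  · have hi : o = i := by
      by_contra hi
      simp [eps, hi, hgt i j hij] at hβ
    subst hi
    rw [hw]
    exact ⟨by simpa using hij.ne', by simp [root]⟩
  · have hi : o = i := by
      by_contra hi
      simp [eps, hi, hgt i j hij] at hβ
    subst hi
    rw [hw]
    exact ⟨by simp, by simp [root, hij.ne']⟩
  · have hi : o = i := by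
      by_contra hi
      simp [eps, hi] at hβ
    subst hi
    rw [hw]
    exact ⟨by simp, by simp [root]⟩

end KostantKumar

theorem lemma2p6 (Φ : KostantKumar.BCType) (n : ℕ) (hn : 2 ≤ n)
    (w : KostantKumar.W n) (hw : w * w = 1) :
    ∃ p : MvPolynomial (Fin n) ℂ,
      algebraMap (MvPolynomial (Fin n) ℂ) (FractionRing (MvPolynomial (Fin n) ℂ)) p =
        KostantKumar.dRat Φ w ∧
      (KostantKumar.supp Φ w ∩ KostantKumar.firstColumn Φ n = ∅ →
        ∀ α ∈ KostantKumar.firstColumn Φ n, KostantKumar.linForm α ∣ p) ∧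
      (∀ β ∈ KostantKumar.supp Φ w ∩ KostantKumar.firstColumn Φ n,
        ¬ KostantKumar.linForm β ∣ p) := by
  let o : Fin n := ⟨0, by omega⟩
  have ho : o.val = 0 := rfl
  refine ⟨KostantKumar.kkFamily Φ w 1, KostantKumar.algebraMap_kkFamily hw, ?_, ?_⟩
  · intro hempty α hα
    have hfix : w.1 (Sum.inl o) = Sum.inl o := by
      by_contra h
      exact Set.eq_empty_iff_forall_notMem.mp hempty _
        ⟨KostantKumar.root_mem_supp ho h, (KostantKumar.mem_firstColumn_iff ho).mpr ⟨_, h, rfl⟩⟩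
    obtain ⟨z, hz, rfl⟩ := (KostantKumar.mem_firstColumn_iff ho).mp hα
    obtain ⟨h1, h2⟩ := Finset.mem_filter.mp (KostantKumar.root_first_mem (Φ := Φ) ho hz)
    exact KostantKumar.linForm_dvd_kkFamily ho hfix h1 h2 1
  · rintro β ⟨hβ, hβ'⟩
    obtain ⟨z, hz, rfl⟩ := (KostantKumar.mem_firstColumn_iff ho).mp hβ'
    have h := (Finset.mem_filter.mp (KostantKumar.root_first_mem (Φ := Φ) ho hz)).2
    obtain ⟨h1, h2⟩ := KostantKumar.eq_root_of_mem_supp ho hβ h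
    rw [h2]
    exact KostantKumar.not_linForm_dvd_kkFamily_one ho hw rfl h1
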